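/- Let $M$ be a compact connected smooth manifold without boundary and let $\mu$ be a smooth positive volume on $M$ (for instance the Riemannian volume of a Riemannian metric). All function spaces carry the Fréchet $C^\infty$ topology. Let $$\mathrm{Dens}(M)=\{\rho\in C^\infty(M,\mathbb R):\rho>0,\ \textstyle\int_M\rho\,\mu=1\},\qquad T^*\mathrm{Dens}(M)=\mathrm{Dens}(M)\times C^\infty(M,\mathbb R)/\mathbb R ,$$ and represent the tangent vectors of $T^*\mathrm{Dens}(M)$ at $(\rho,[\theta])$ by pairs $(\dot\rho,\dot\theta)$ of smooth functions with $\int_M\dot\rho\,\mu=0=\int_M\dot\theta\rho\,\mu$. On $T^*\mathrm{Dens}(M)$ consider the Sasaki–Fisher–Rao metric $$\bar G^*\big((\dot\rho_1,\dot\theta_1),(\dot\rho_2,\dot\theta_2)\big)=\tfrac14\int_M\Big(\tfrac{\dot\rho_1}{\rho}\tfrac{\dot\rho_2}{\rho}+\dot\theta_1\dot\theta_2\Big)\rho\,\mu ,$$ the canonical symplectic form $\omega\big((\dot\rho_1,\dot\theta_1),(\dot\rho_2,\dot\theta_2)\big)=\int_M(\dot\rho_1\dot\theta_2-\dot\rho_2\dot\theta_1)\,\mu$,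 and $J(\dot\rho,\dot\theta)=(-\rho\dot\theta,\dot\rho/\rho)$. Then $J^2=-1$, $\bar G^*$ is positive definite and $\bar G^*(J\cdot,\cdot)=\tfrac14\omega$. Let $PC^\infty(M,\mathbb C)$ be the quotient of $\{\psi\in C^\infty(M,\mathbb C):\int_M|\psi|^2\mu=1\}$ by multiplication by constant phases, with the smooth structure given by the affine charts $[\psi]\mapsto\psi/\langle\varphi,\psi\rangle-\varphi\in\varphi^\perp$, where $\langle\varphi,\psi\rangle=\int_M\bar\varphi\psi\,\mu$ and $[\varphi]\in PC^\infty(M,\mathbb C)$. Its Fubini–Study metric and symplectic form at $[\psi]$ are the real and the imaginary part of $$\frac{\langle\dot\psi_1,\dot\psi_2\rangle}{\langle\psi,\psi\rangle}-\frac{\langle\dot\psi_1,\psi\rangle\langle\psi,\dot\psi_2\rangle}{\langle\psi,\psi\rangle^2},$$ and its complex structure is multiplication by $i$. Then the Madelung transform $\Phi(\rho,[\theta])=[\sqrt{\rho e^{i\theta}}]=[\sqrt\rho\,e^{i\theta/2}]$ is a well-defined Kähler morphism from $T^*\mathrm{Dens}(M)$ onto an open subset of $PC^\infty(M,\mathbb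 C)$. That is: its image is open; $\Phi$ is a diffeomorphism of Fréchet manifolds onto its image; and at every point its differential is a linear isomorphism of tangent spaces which carries the Sasaki–Fisher–Rao metric to the Fubini–Study metric, $\omega$ to $4$ times the symplectic form of $PC^\infty(M,\mathbb C)$, and $J$ to multiplication by $i$. The image is contained in the set $PC^\infty(M,\mathbb C\setminus\{0\})$ of classes of nowhere vanishing functions, and equals it if $M$ is simply connected. -/

import Mathlib

open Set Filter MeasureTheory
set_option linter.unusedSectionVars false

open scoped Topology Manifold ContDiff ComplexConjugate

noncomputable section

namespace MadelungKahler

universe u w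

/-! ### Differential calculus in (possibly non-normable) topological vector spaces -/

/-- `w` is the directional derivative of `f` at `x` in the direction `v`. -/
def HasDirDeriv {E : Type*} {F : Type*} [AddCommGroup E] [Module ℝ E]
    [AddCommGroup F] [Module ℝ F] [TopologicalSpace F]
    (f : E → F) (x v : E) (w : F) : Prop :=
  Tendsto (fun t : ℝ => t⁻¹ • (f (x + t • v) - f x)) (𝓝[≠] 0) (𝓝 w)

/-- `f` is `C^k` on the open set `s` in the usual sense of calculus in Fréchet spaces
(Michal, Bastiani, Hamilton): all directional derivatives exist and the map
`(x, v) ↦ Df(x) v` on `s × E` is of class `C^{k-1}`. -/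
def CkOn {F : Type w} [AddCommGroup F] [Module ℝ F] [TopologicalSpace F] :
    ℕ → ∀ {E : Type u} [AddCommGroup E] [Module ℝ E] [TopologicalSpace E],
      (E → F) → Set E → Prop
  | 0, _, _, _, _, f, s => ContinuousOn f s
  | k + 1, E, _, _, _, f, s => ContinuousOn f s ∧
      ∃ f' : E × E → F, (∀ x ∈ s, ∀ v, HasDirDeriv f x v (f' (x, v))) ∧
        CkOn k f' (s ×ˢ (univ : Set E))

/-- Smooth maps on an open subset of a Fréchet space. -/
def SmoothMapOn {E : Type u} {F : Type w} [AddCommGroup E] [Module ℝ E] [TopologicalSpace E]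
    [AddCommGroup F] [Module ℝ F] [TopologicalSpace F] (f : E → F) (s : Set E) : Prop :=
  ∀ k, CkOn k f s

/-- A chart on `X` with values in a topological vector space. -/
structure VChart (X : Type u) where
  /-- the model vector space of the chart -/
  Model : Type u
  [grp : AddCommGroup Model]
  [mod : Module ℝ Model]
  [top : TopologicalSpace Model]
  /-- the chart itself, from its domain to its image -/
  chart : PartialEquiv X Model

attribute [instance] VChart.grp VChart.mod VChart.top

/-- `f : X → Y` is smooth on the open set `s`, with respect to an atlas `A` of `X` and an
atlas `B` of `Y`: it is continuous, and smooth when read in all charts. -/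
def MapSmoothOn {X Y : Type u} [TopologicalSpace X] [TopologicalSpace Y]
    (A : Set (VChart X)) (B : Set (VChart Y)) (f : X → Y) (s : Set X) : Prop :=
  ContinuousOn f s ∧ ∀ c ∈ A, ∀ d ∈ B,
    SmoothMapOn (fun e => d.chart (f (c.chart.symm e)))
      (c.chart.target ∩ c.chart.symm ⁻¹' (s ∩ f ⁻¹' d.chart.source))

/-! ### Spaces of smooth functions with their Fréchet topology -/

section Functions

variable {n : ℕ} {M : Type u} [TopologicalSpace M] [ChartedSpace (EuclideanSpace ℝ (Fin n)) M]

variable (n M) in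
/-- Smooth functions on `M` with values in the normed space `V`. -/
abbrev SmoothFun (V : Type) [NormedAddCommGroup V] [NormedSpace ℝ V] : Type u :=
  C^∞⟮𝓡 n, M; 𝓘(ℝ, V), V⟯

variable (n M) in
/-- Smooth vector fields on `M`. -/
abbrev SmoothVectorField [IsManifold (𝓡 n) ∞ M] : Type u :=
  Cₛ^∞⟮𝓡 n; EuclideanSpace ℝ (Fin n), (TangentSpace (𝓡 n) : M → Type)⟯

variable [IsManifold (𝓡 n) ∞ M]

/-- The derivative `X f` of a function `f` along the vector field `X`. -/
def derivAlong {V : Type} [NormedAddCommGroup V] [NormedSpace ℝ V]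
    (X : SmoothVectorField n M) (f : M → V) : M → V :=
  fun x => (mfderiv (𝓡 n) 𝓘(ℝ, V) f x (X x) : V)

/-- The iterated derivative `X₁ (X₂ (⋯ (Xₖ f)))`. -/
def iterDerivAlong {V : Type} [NormedAddCommGroup V] [NormedSpace ℝ V]
    (Xs : List (SmoothVectorField n M)) (f : M → V) : M → V :=
  Xs.foldr derivAlong f

/-- The Fréchet topology on the smooth functions on the compact manifold `M`: uniform convergence
of the functions and of all their iterated derivatives along smooth vector fields. -/
instance frechetTopology [CompactSpace M] {V : Type} [NormedAddCommGroup V] [NormedSpace ℝ V] :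
    TopologicalSpace (SmoothFun n M V) :=
  ⨅ Xs : List (SmoothVectorField n M),
    TopologicalSpace.induced
      (fun f : SmoothFun n M V => UniformFun.ofFun (iterDerivAlong Xs f)) inferInstance

end Functions

section Main

variable {n : ℕ} {M : Type u} [TopologicalSpace M] [ChartedSpace (EuclideanSpace ℝ (Fin n)) M]

/-- `μ` is a smooth positive volume on `M`: in each chart of the atlas it has a smooth positive
density with respect to Lebesgue measure. Riemannian volumes are of this form. -/
def IsSmoothVolume (n : ℕ) {M : Type u} [TopologicalSpace M]
    [ChartedSpace (EuclideanSpace ℝ (Fin n)) M] [MeasurableSpace M] (μ : Measure M) : Prop :=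
  ∀ e ∈ atlas (EuclideanSpace ℝ (Fin n)) M, ∃ h : EuclideanSpace ℝ (Fin n) → ℝ,
    ContDiffOn ℝ ∞ h e.target ∧ (∀ y ∈ e.target, 0 < h y) ∧
      ∀ A ⊆ e.source, MeasurableSet A → μ A = ∫⁻ y in e '' A, ENNReal.ofReal (h y)

/-- Multiplication of a complex function by a complex constant. -/
def cmul (c : ℂ) (ψ : SmoothFun n M ℂ) : SmoothFun n M ℂ :=
  ⟨fun x => c * ψ x,
    ((ContinuousLinearMap.mul ℝ ℂ c).contDiff.contMDiff.comp ψ.contMDiff :)⟩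

@[simp] lemma cmul_apply (c : ℂ) (ψ : SmoothFun n M ℂ) (x : M) : cmul c ψ x = c * ψ x := rfl

lemma cmul_cmul (c d : ℂ) (ψ : SmoothFun n M ℂ) : cmul c (cmul d ψ) = cmul (c * d) ψ := by
  ext x; simp [mul_assoc]

variable [CompactSpace M] [MeasurableSpace M] [BorelSpace M] (μ : Measure M) [IsFiniteMeasure μ]

lemma integrable_of_continuous {V : Type} [NormedAddCommGroup V] {f : M → V}
    (hf : Continuous f) : Integrable f μ :=
  hf.integrable_of_hasCompactSupport (HasCompactSupport.of_compactSpace f)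

lemma integrable_fun {V : Type} [NormedAddCommGroup V] [NormedSpace ℝ V]
    (f : SmoothFun n M V) : Integrable f μ :=
  integrable_of_continuous μ f.contMDiff.continuous

/-! ### The cotangent bundle of the space of densities -/

variable (n) in
/-- `Dens(M)`: a smooth positive density `ϱ = ρ μ` of total mass `1` is given by `ρ`. -/
abbrev Dens : Type u :=
  {ρ : SmoothFun n M ℝ // (∀ x, 0 < ρ x) ∧ ∫ x, ρ x ∂μ = 1}

variable (n M) in
/-- The constant functions. -/
def constants : Submodule ℝ (SmoothFun n M ℝ) where
  carrier := {f | ∃ c : ℝ, ∀ x, f x = c}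
  add_mem' := by
    rintro f g ⟨c, hc⟩ ⟨d, hd⟩
    exact ⟨c + d, fun x => by simp [hc, hd]⟩
  zero_mem' := ⟨0, fun x => rfl⟩
  smul_mem' := by
    rintro r f ⟨c, hc⟩
    exact ⟨r * c, fun x => by simp [hc]⟩

variable (n) in
/-- Functions of mean zero: `α = f μ` with total integral `0`. -/
def meanZero : Submodule ℝ (SmoothFun n M ℝ) where
  carrier := {f | ∫ x, f x ∂μ = 0}
  add_mem' := by
    intro f g hf hg
    have := integral_add (integrable_fun μ f) (integrable_fun μ g)
    simp only [mem_ofPred_eq] at hf hg ⊢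
    simpa [hf, hg] using this
  zero_mem' := by simp
  smul_mem' := by
    intro r f hf
    have := integral_const_mul (μ := μ) r (fun x => f x)
    simp only [mem_ofPred_eq] at hf ⊢
    simpa [hf] using this


variable (n) in
/-- The (smooth) cotangent bundle `T*Dens(M) = Dens(M) × C^∞(M)/ℝ`. -/
abbrev CotDens : Type u := Dens n μ × (SmoothFun n M ℝ ⧸ constants n M)

section Topology

variable [IsManifold (𝓡 n) ∞ M]

open Classical in
/-- The affine chart of `T*Dens(M)` with origin at the density `ρ₀`:
`(ρ, [θ]) ↦ (ρ - ρ₀, [θ])`. -/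
def cotChart (ρ₀ : Dens n μ) : VChart (CotDens n μ) where
  Model := meanZero n μ × (SmoothFun n M ℝ ⧸ constants n M)
  chart :=
    { toFun := fun p => (⟨p.1.1 - ρ₀.1, by
          have h := integral_sub (integrable_fun μ p.1.1) (integrable_fun μ ρ₀.1)
          rw [p.1.2.2, ρ₀.2.2, sub_self] at h
          exact h⟩, p.2)
      invFun := fun a =>
        if h : ∀ x, 0 < (ρ₀.1 + a.1.1) x then (⟨ρ₀.1 + a.1.1, h, by
          have h := integral_add (integrable_fun μ ρ₀.1) (integrable_fun μ a.1.1)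
          rw [ρ₀.2.2, show ∫ x, a.1.1 x ∂μ = 0 from a.1.2, add_zero] at h
          exact h⟩, a.2)
        else (ρ₀, a.2)
      source := univ
      target := {a | ∀ x, 0 < ρ₀.1 x + a.1.1 x}
      map_source' := by
        intro p _ x
        have : ρ₀.1 x + (p.1.1 x - ρ₀.1 x) = p.1.1 x := by ring
        exact this ▸ p.1.2.1 x
      map_target' := fun _ _ => mem_univ _
      left_inv' := by
        intro p _
        have e : ρ₀.1 + (p.1.1 - ρ₀.1) = p.1.1 := by abel
        have h : ∀ x, 0 < (ρ₀.1 + (p.1.1 - ρ₀.1)) x := by rw [e]; exact p.1.2.1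
        simp only [dif_pos h]
        exact Prod.ext (Subtype.ext e) rfl
      right_inv' := by
        intro a ha
        have h : ∀ x, 0 < (ρ₀.1 + a.1.1) x := ha
        simp only [dif_pos h]
        refine Prod.ext (Subtype.ext ?_) rfl
        simp }

variable (n) in
/-- The Fréchet manifold structure of `T*Dens(M)`. -/
def cotAtlas : Set (VChart (CotDens n μ)) := range (cotChart μ)

end Topology

/-- The tangent space of `T*Dens(M)` at `(ρ, [θ])`: its elements are the pairs `(ρ', θ')` with
`∫ ρ' μ = 0` and `∫ θ' ρ μ = 0`; here `θ'` is the representative of a class in `C^∞(M)/ℝ` which is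
normalised by the second equation. -/
def cotTangent (p : CotDens n μ) : Submodule ℝ (SmoothFun n M ℝ × SmoothFun n M ℝ) where
  carrier := {v | ∫ x, v.1 x ∂μ = 0 ∧ ∫ x, v.2 x * p.1.1 x ∂μ = 0}
  add_mem' := by
    rintro v w ⟨hv, hv'⟩ ⟨hw, hw'⟩
    have h := integral_add (integrable_fun μ v.1) (integrable_fun μ w.1)
    have h' := integral_add (integrable_of_continuous μ
      (v.2.contMDiff.continuous.mul p.1.1.contMDiff.continuous)) (integrable_of_continuous μ
      (w.2.contMDiff.continuous.mul p.1.1.contMDiff.continuous))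
    rw [hv, hw, add_zero] at h
    replace h' := h'.trans ((congrArg₂ _ hv' hw').trans (add_zero _))
    refine ⟨h, ?_⟩
    refine (integral_congr_ae (Eventually.of_forall fun x => ?_)).trans h'
    exact add_mul (v.2 x) (w.2 x) _
  zero_mem' := by simp
  smul_mem' := by
    rintro r v ⟨hv, hv'⟩
    have h := integral_const_mul (μ := μ) r (fun x => v.1 x)
    have h' := integral_const_mul (μ := μ) r (fun x => v.2 x * p.1.1 x)
    rw [hv, mul_zero] at h
    rw [hv', mul_zero] at h'
    refine ⟨h, ?_⟩
    exact (integral_congr_ae (Eventually.of_forall fun x => mul_assoc r (v.2 x) _)).trans h'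

/-- The tangent vector `(ρ', θ')` read in the charts of `T*Dens(M)`, namely `(ρ', [θ'])`. -/
def cotTangent.coord {p : CotDens n μ} (v : cotTangent μ p) :
    meanZero n μ × (SmoothFun n M ℝ ⧸ constants n M) :=
  (⟨v.1.1, v.2.1⟩, Submodule.Quotient.mk v.1.2)

/-- The Sasaki--Fisher--Rao metric `¼ ∫ ((ρ₁'/ρ) (ρ₂'/ρ) + θ₁' θ₂') ρ μ`. -/
def sasakiFisherRao {p : CotDens n μ} (v w : cotTangent μ p) : ℝ :=
  1 / 4 * ∫ x, ((v.1.1 x / p.1.1 x) * (w.1.1 x / p.1.1 x) + v.1.2 x * w.1.2 x) * p.1.1 x ∂μ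

/-- The canonical symplectic form `dρ ∧ dθ` of the cotangent bundle, that is, the pairing of
`θ₂'` with `ρ₁'` minus the pairing of `θ₁'` with `ρ₂'`. -/
def canonicalForm {p : CotDens n μ} (v w : cotTangent μ p) : ℝ :=
  ∫ x, (v.1.1 x * w.1.2 x - w.1.1 x * v.1.2 x) ∂μ

/-- The almost complex structure `J (ρ', θ') = (-ρ θ', ρ' / ρ)` of `T*Dens(M)`. -/
def cotJ {p : CotDens n μ} (v : cotTangent μ p) : cotTangent μ p :=
  ⟨(⟨fun x => -(v.1.2 x * p.1.1 x), ((contDiff_mul.neg).contMDiff.comp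
        (v.1.2.contMDiff.prodMk_space p.1.1.contMDiff) :)⟩,
    ⟨fun x => v.1.1 x / p.1.1 x,
      v.1.1.contMDiff.div₀ p.1.1.contMDiff fun x => (p.1.2.1 x).ne'⟩), by
    refine ⟨?_, ?_⟩
    · have h := integral_neg (μ := μ) (fun x => v.1.2 x * p.1.1 x)
      rw [v.2.2, neg_zero] at h
      exact h
    · exact (integral_congr_ae (Eventually.of_forall fun x =>
        div_mul_cancel₀ (v.1.1 x) (p.1.2.1 x).ne')).trans v.2.1⟩

/-! ### The complex projective space of wave functions -/

/-- The Hermitian `L²` inner product, conjugate linear in the first argument. -/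
def l2 (φ ψ : SmoothFun n M ℂ) : ℂ := ∫ x, conj (φ x) * ψ x ∂μ

lemma continuous_l2_aux (φ ψ : SmoothFun n M ℂ) : Continuous fun x => conj (φ x) * ψ x :=
  (Complex.continuous_conj.comp φ.contMDiff.continuous).mul ψ.contMDiff.continuous

lemma l2_add (φ ψ χ : SmoothFun n M ℂ) : l2 μ φ (ψ + χ) = l2 μ φ ψ + l2 μ φ χ := by
  rw [l2, l2, l2, ← integral_add (integrable_of_continuous μ (continuous_l2_aux φ ψ))
    (integrable_of_continuous μ (continuous_l2_aux φ χ))]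
  exact integral_congr_ae (Eventually.of_forall fun x => mul_add _ _ _)

lemma l2_cmul (c : ℂ) (φ ψ : SmoothFun n M ℂ) : l2 μ φ (cmul c ψ) = c * l2 μ φ ψ := by
  rw [l2, l2, ← integral_const_mul]
  exact integral_congr_ae (Eventually.of_forall fun x => by simp; ring)

lemma l2_conj (φ ψ : SmoothFun n M ℂ) : conj (l2 μ φ ψ) = l2 μ ψ φ := by
  rw [l2, l2, ← integral_conj]
  exact integral_congr_ae (Eventually.of_forall fun x => by simp [mul_comm])

lemma l2_cmul_left (c : ℂ) (φ ψ : SmoothFun n M ℂ) :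
    l2 μ (cmul c φ) ψ = conj c * l2 μ φ ψ := by
  rw [← l2_conj, l2_cmul, map_mul, l2_conj]

lemma l2_add_left (φ ψ χ : SmoothFun n M ℂ) : l2 μ (ψ + χ) φ = l2 μ ψ φ + l2 μ χ φ := by
  rw [← l2_conj, l2_add, map_add, l2_conj, l2_conj]

lemma l2_self (ψ : SmoothFun n M ℂ) : l2 μ ψ ψ = ((∫ x, ‖ψ x‖ ^ 2 ∂μ : ℝ) : ℂ) := by
  rw [l2, ← integral_complex_ofReal]
  exact integral_congr_ae (Eventually.of_forall fun x => by simp [Complex.conj_mul'])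

lemma integral_normSq_cmul (c : ℂ) (ψ : SmoothFun n M ℂ) :
    ∫ x, ‖cmul c ψ x‖ ^ 2 ∂μ = ‖c‖ ^ 2 * ∫ x, ‖ψ x‖ ^ 2 ∂μ := by
  rw [← integral_const_mul]
  exact integral_congr_ae (Eventually.of_forall fun x => by simp [mul_pow])

variable (n) in
/-- The unit sphere of smooth wave functions. -/
abbrev Sphere : Type u := {ψ : SmoothFun n M ℂ // ∫ x, ‖ψ x‖ ^ 2 ∂μ = 1}

lemma Sphere.l2_self (φ : Sphere n μ) : l2 μ φ.1 φ.1 = 1 := by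
  rw [MadelungKahler.l2_self, φ.2, Complex.ofReal_one]

variable (n) in
/-- Two unit wave functions are identified if they differ by a constant phase. -/
def phaseSetoid : Setoid (Sphere n μ) where
  r ψ ψ' := ∃ α : ℝ, ψ'.1 = cmul (Complex.exp (α * Complex.I)) ψ.1
  iseqv :=
    { refl := fun ψ => ⟨0, by ext x; simp⟩
      symm := by
        rintro ψ ψ' ⟨α, h⟩
        refine ⟨-α, ?_⟩
        rw [h, cmul_cmul, ← Complex.exp_add]
        ext x; simp
      trans := by
        rintro ψ ψ' ψ'' ⟨α, h⟩ ⟨β, h'⟩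
        refine ⟨β + α, ?_⟩
        rw [h', h, cmul_cmul, ← Complex.exp_add]
        congr 2; push_cast; ring }

variable (n) in
/-- The complex projective space `PC^∞(M, ℂ)` of smooth wave functions. -/
abbrev ProjWave : Type u := Quotient (phaseSetoid n μ)

/-- The class `[ψ]` of a unit wave function. -/
def ProjWave.mk (ψ : Sphere n μ) : ProjWave n μ := Quotient.mk (phaseSetoid n μ) ψ

variable (n) in
/-- `PC^∞(M, ℂ ∖ {0})`: the classes of nowhere vanishing wave functions. -/
def nonvanishing : Set (ProjWave n μ) := {q | ∃ ψ : Sphere n μ, (∀ x, ψ.1 x ≠ 0) ∧ q = .mk μ ψ}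

/-- The orthogonal complement of `ψ`. It is the model space of the affine chart around `[ψ]` and
represents the tangent space at `[ψ]`, as the tangent vectors which are horizontal at `ψ`. -/
def horiz (ψ : SmoothFun n M ℂ) : Submodule ℝ (SmoothFun n M ℂ) where
  carrier := {χ | l2 μ ψ χ = 0}
  add_mem' := by
    intro f g hf hg
    exact (l2_add μ ψ f g).trans (by rw [show l2 μ ψ f = 0 from hf, show l2 μ ψ g = 0 from hg,
      add_zero])
  zero_mem' := by simp [l2]
  smul_mem' := by
    intro r f hf
    have : r • f = cmul (r : ℂ) f := by ext x; simp
    exact (congrArg _ this).trans ((l2_cmul μ _ ψ f).trans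
      (by rw [show l2 μ ψ f = 0 from hf, mul_zero]))

/-- The affine coordinate `ψ / ⟨φ, ψ⟩ - φ` around `[φ]` (for `⟨φ, ψ⟩ ≠ 0`). -/
def affineCoord (φ ψ : Sphere n μ) : horiz μ φ.1 :=
  ⟨cmul (l2 μ φ.1 ψ.1)⁻¹ (ψ.1 + cmul (-l2 μ φ.1 ψ.1) φ.1), by
    change l2 μ _ _ = 0
    rw [l2_cmul, l2_add, l2_cmul, φ.l2_self]; ring⟩

lemma normSq_add_horiz (φ : Sphere n μ) (χ : horiz μ φ.1) :
    ∫ x, ‖(φ.1 + χ.1) x‖ ^ 2 ∂μ = 1 + ∫ x, ‖χ.1 x‖ ^ 2 ∂μ := by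
  have hχ : l2 μ φ.1 χ.1 = 0 := χ.2
  have h : l2 μ (φ.1 + χ.1) (φ.1 + χ.1) = l2 μ φ.1 φ.1 + l2 μ χ.1 χ.1 := by
    rw [l2_add, l2_add_left, l2_add_left, hχ, ← l2_conj μ φ.1 χ.1, hχ]; simp
  rw [l2_self, l2_self, l2_self, φ.2] at h
  exact_mod_cast h

lemma normSq_add_horiz_pos (φ : Sphere n μ) (χ : horiz μ φ.1) :
    0 < ∫ x, ‖(φ.1 + χ.1) x‖ ^ 2 ∂μ := by
  rw [normSq_add_horiz]
  have : 0 ≤ ∫ x, ‖χ.1 x‖ ^ 2 ∂μ := integral_nonneg fun x => by positivity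
  linarith

/-- The unit wave function `(φ + χ) / ‖φ + χ‖`. -/
def affinePoint (φ : Sphere n μ) (χ : horiz μ φ.1) : Sphere n μ :=
  ⟨cmul ((Real.sqrt (∫ x, ‖(φ.1 + χ.1) x‖ ^ 2 ∂μ))⁻¹ : ℝ) (φ.1 + χ.1), by
    have h := normSq_add_horiz_pos μ φ χ
    rw [integral_normSq_cmul, Complex.norm_real, Real.norm_eq_abs, sq_abs, inv_pow,
      Real.sq_sqrt h.le, inv_mul_cancel₀ h.ne']⟩

section Topology

variable [IsManifold (𝓡 n) ∞ M]

/-- The affine chart of `PC^∞(M, ℂ)` around `[φ]`: it sends `[ψ]` with `⟨φ, ψ⟩ ≠ 0` to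
`ψ / ⟨φ, ψ⟩ - φ`. -/
def projChart (φ : Sphere n μ) : VChart (ProjWave n μ) where
  Model := horiz μ φ.1
  chart :=
    { toFun := Quotient.lift (affineCoord μ φ) (by
        rintro ψ ψ' ⟨α, h⟩
        have hα : Complex.exp (α * Complex.I) ≠ 0 := Complex.exp_ne_zero _
        apply Subtype.ext
        ext x
        simp only [affineCoord, h, l2_cmul, cmul_apply, ContMDiffMap.coe_add, Pi.add_apply]
        field_simp)
      invFun := fun χ => .mk μ (affinePoint μ φ χ)
      source := {q | ∃ ψ : Sphere n μ, l2 μ φ.1 ψ.1 ≠ 0 ∧ q = .mk μ ψ}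
      target := univ
      map_source' := fun _ _ => mem_univ _
      map_target' := by
        intro χ _
        refine ⟨affinePoint μ φ χ, ?_, rfl⟩
        have h := Real.sqrt_pos.2 (normSq_add_horiz_pos μ φ χ)
        rw [affinePoint, l2_cmul, l2_add, φ.l2_self, show l2 μ φ.1 χ.1 = 0 from χ.2, add_zero,
          mul_one]
        exact_mod_cast (inv_pos.2 h).ne'
      left_inv' := by
        rintro q ⟨ψ, hψ, rfl⟩
        change ProjWave.mk μ (affinePoint μ φ (affineCoord μ φ ψ)) = ProjWave.mk μ ψ
        have e : φ.1 + (affineCoord μ φ ψ).1 = cmul (l2 μ φ.1 ψ.1)⁻¹ ψ.1 := by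
          ext x
          simp only [affineCoord, cmul_apply, ContMDiffMap.coe_add, Pi.add_apply]
          field_simp
          ring
        refine Quotient.sound ⟨Complex.arg (l2 μ φ.1 ψ.1), ?_⟩
        rw [affinePoint, cmul_cmul]
        change ψ.1 = cmul _ (φ.1 + (affineCoord μ φ ψ).1)
        rw [e, integral_normSq_cmul, ψ.2, mul_one, Real.sqrt_sq (norm_nonneg _), cmul_cmul]
        have : Complex.exp (Complex.arg (l2 μ φ.1 ψ.1) * Complex.I) *
            ((‖(l2 μ φ.1 ψ.1)⁻¹‖⁻¹ : ℝ) : ℂ) * (l2 μ φ.1 ψ.1)⁻¹ = 1 := by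
          rw [norm_inv, inv_inv, mul_comm (Complex.exp _), Complex.norm_mul_exp_arg_mul_I,
            mul_inv_cancel₀ hψ]
        rw [this]
        ext x; simp
      right_inv' := by
        intro χ _
        change affineCoord μ φ (affinePoint μ φ χ) = χ
        have h := Real.sqrt_pos.2 (normSq_add_horiz_pos μ φ χ)
        have h' : (Real.sqrt (∫ x, ‖(φ.1 + χ.1) x‖ ^ 2 ∂μ) : ℂ) ≠ 0 := by exact_mod_cast h.ne'
        apply Subtype.ext
        ext x
        simp only [affineCoord, affinePoint, l2_cmul, l2_add, φ.l2_self,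
          show l2 μ φ.1 χ.1 = 0 from χ.2, cmul_apply, ContMDiffMap.coe_add, Pi.add_apply,
          Complex.ofReal_inv, add_zero, mul_one, inv_inv]
        simp only [ContMDiffMap.coe_add, Pi.add_apply] at h'
        field_simp
        ring }

variable (n) in
/-- The Fréchet manifold structure of `PC^∞(M, ℂ)`, given by the affine charts. -/
def projAtlas : Set (VChart (ProjWave n μ)) := range (projChart μ)

end Topology

/-- The Hermitian Fubini--Study form
`⟨ψ₁', ψ₂'⟩ / ⟨ψ, ψ⟩ - ⟨ψ₁', ψ⟩ ⟨ψ, ψ₂'⟩ / ⟨ψ, ψ⟩²` at `[ψ]`. -/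
def hermitianFubiniStudy (ψ ψ₁ ψ₂ : SmoothFun n M ℂ) : ℂ :=
  l2 μ ψ₁ ψ₂ / l2 μ ψ ψ - l2 μ ψ₁ ψ * l2 μ ψ ψ₂ / l2 μ ψ ψ ^ 2

/-- The Fubini--Study metric. -/
def fubiniStudy (ψ ψ₁ ψ₂ : SmoothFun n M ℂ) : ℝ := (hermitianFubiniStudy μ ψ ψ₁ ψ₂).re

/-- The symplectic form of projective space, the imaginary part of the Hermitian form. -/
def projForm (ψ ψ₁ ψ₂ : SmoothFun n M ℂ) : ℝ := (hermitianFubiniStudy μ ψ ψ₁ ψ₂).im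

/-! ### The Madelung transform -/

/-- The Madelung transform `√(ρ e^{iθ}) = √ρ e^{iθ/2}`. -/
def madelungFun (ρ : Dens n μ) (θ : SmoothFun n M ℝ) : SmoothFun n M ℂ :=
  ⟨fun x => (Real.sqrt (ρ.1 x) : ℂ) * Complex.exp (Complex.I * (θ x / 2 : ℝ)), by
    intro x
    have h : ContDiffAt ℝ ∞ (fun a : ℝ × ℝ =>
        (Real.sqrt a.1 : ℂ) * Complex.exp (Complex.I * (a.2 / 2 : ℝ))) (ρ.1 x, θ x) := by
      have h1 : ContDiffAt ℝ ∞ (fun a : ℝ × ℝ => Real.sqrt a.1) (ρ.1 x, θ x) :=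
        contDiffAt_fst.sqrt (ρ.2.1 x).ne'
      have h2 : ContDiffAt ℝ ∞ (fun a : ℝ × ℝ => a.2 / 2) (ρ.1 x, θ x) :=
        contDiffAt_snd.div_const 2
      have h3 := Complex.ofRealCLM.contDiff.contDiffAt.comp (ρ.1 x, θ x) h1
      have h4 := Complex.ofRealCLM.contDiff.contDiffAt.comp (ρ.1 x, θ x) h2
      exact h3.mul (contDiffAt_const.mul h4).cexp
    exact h.contMDiffAt.comp x (ρ.1.contMDiff.prodMk_space θ.contMDiff x)⟩

lemma normSq_madelungFun (ρ : Dens n μ) (θ : SmoothFun n M ℝ) (x : M) :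
    ‖madelungFun μ ρ θ x‖ ^ 2 = ρ.1 x := by
  change ‖(Real.sqrt (ρ.1 x) : ℂ) * Complex.exp (Complex.I * (θ x / 2 : ℝ))‖ ^ 2 = _
  rw [norm_mul, mul_comm Complex.I, Complex.norm_exp_ofReal_mul_I, mul_one, Complex.norm_real,
    Real.norm_eq_abs, sq_abs, Real.sq_sqrt (ρ.2.1 x).le]

/-- The Madelung transform with values in the unit sphere. -/
def madelungSphere (ρ : Dens n μ) (θ : SmoothFun n M ℝ) : Sphere n μ :=
  ⟨madelungFun μ ρ θ, by simp_rw [normSq_madelungFun]; exact ρ.2.2⟩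

/-- The induced map `Φ : T*Dens(M) → PC^∞(M, ℂ)`, `(ρ, [θ]) ↦ [√(ρ e^{iθ})]`. -/
def madelung (p : CotDens n μ) : ProjWave n μ :=
  Quotient.liftOn' p.2 (fun θ => ProjWave.mk μ (madelungSphere μ p.1 θ)) (by
    intro θ θ' h
    obtain ⟨c, hc⟩ := (Submodule.quotientRel_def _).1 h
    refine Quotient.sound ⟨-(c / 2), ?_⟩
    ext x
    have hx : θ x = θ' x + c := by
      have : θ x - θ' x = c := hc x
      linarith
    change (Real.sqrt (p.1.1 x) : ℂ) * Complex.exp (Complex.I * (θ' x / 2 : ℝ)) =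
      Complex.exp ((-(c / 2) : ℝ) * Complex.I) *
        ((Real.sqrt (p.1.1 x) : ℂ) * Complex.exp (Complex.I * (θ x / 2 : ℝ)))
    rw [mul_left_comm, ← Complex.exp_add, hx]
    congr 2
    push_cast
    ring)

end Main

end MadelungKahler
end

noncomputable section

namespace MadelungKahler

universe u w

/-! ### Strict directional derivatives -/

section Calculus

/-! Write $\psi=\sqrt\rho\,e^{i\theta/2}$. Then $|\psi|^2=\rho$, and $\theta/2$ is a continuous
argument of $\psi$, so $\theta$ is determined up to a locally constant multiple of $4\pi$; on a
connected $M$ this multiple is constant and vanishes in $C^\infty(M)/\mathbb R$. This is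
`madelung_injective`. Conversely, if $\chi/\psi$ avoids the closed negative real axis, then
$\theta+2\arg(\chi/\psi)$ is a smooth phase of twice the argument of $\chi$ (`madelungFun_density`).
Such $\chi$ form an open set, so the image is open and this formula is a local inverse. On a simply
connected $M$ every nowhere vanishing function has a global logarithm.

The logarithmic derivative of $\psi$ is $\dot\rho/(2\rho)+i\dot\theta/2$. Multiplying it by
$|\psi|^2=\rho$ gives $(\dot\rho+i\rho\dot\theta)/2$: the two normalisations of a tangent vector are
the real and imaginary parts of orthogonality to $\psi$, so the correction term of the Fubini–Study
form drops out. The Hermitian product of two such derivatives has the Sasaki–Fisher–Rao integrand as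
real part and a quarter of the symplectic integrand as imaginary part (`conj_mul_logDeriv_mul`), and
$J$ is multiplication of the logarithmic derivative by $i$. In the affine chart centred at $[\psi]$
the chart map acts as the identity on horizontal vectors (`hasStrictDirDeriv_affineOp`), which
identifies the differential of $\Phi$ with this formula.

For smoothness, the coordinate expressions are built from continuous affine maps and superposition
operators $f\mapsto g\circ f$ with $g$ smooth between normed spaces. The analytic core is therefore
`strictCkOn_compOp`. With $Tg(a,b)=Dg(a)b$ one has $X(g\circ f)=Tg\circ(f,Xf)$, so the control of
$k+1$ field derivatives for $g$ reduces to $k$ for $Tg$; and the derivative of $f\mapsto g\circ f$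
is again superposition, by $Tg$. Directional derivatives are taken in the strict sense because then
the chain rule is a mere substitution, without local convexity or a mean value theorem. -/

/-- `w` is the strict directional derivative of `f` at `x` in the direction `v`: the difference
quotients converge jointly in the base point, the direction and the increment. -/
def HasStrictDirDeriv {E : Type*} {F : Type*} [AddCommGroup E] [Module ℝ E] [TopologicalSpace E]
    [AddCommGroup F] [Module ℝ F] [TopologicalSpace F]
    (f : E → F) (x v : E) (w : F) : Prop :=
  Tendsto (fun p : E × E × ℝ => p.2.2⁻¹ • (f (p.1 + p.2.2 • p.2.1) - f p.1))
    (𝓝 x ×ˢ 𝓝 v ×ˢ 𝓝[≠] 0) (𝓝 w)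

/-- Maps of class `C^k` on `s`, with strict directional derivatives. -/
def StrictCkOn {F : Type w} [AddCommGroup F] [Module ℝ F] [TopologicalSpace F] :
    ℕ → ∀ {E : Type u} [AddCommGroup E] [Module ℝ E] [TopologicalSpace E],
      (E → F) → Set E → Prop
  | 0, _, _, _, _, f, s => ContinuousOn f s
  | k + 1, E, _, _, _, f, s => ContinuousOn f s ∧
      ∃ f' : E × E → F, (∀ x ∈ s, ∀ v, HasStrictDirDeriv f x v (f' (x, v))) ∧
        StrictCkOn k f' (s ×ˢ (univ : Set E))

variable {E : Type*} {F : Type*} {G : Type*}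
  [AddCommGroup E] [Module ℝ E] [TopologicalSpace E]
  [AddCommGroup F] [Module ℝ F] [TopologicalSpace F]
  [AddCommGroup G] [Module ℝ G] [TopologicalSpace G]

lemma HasStrictDirDeriv.hasDirDeriv {f : E → F} {x v : E} {w : F}
    (h : HasStrictDirDeriv f x v w) : HasDirDeriv f x v w :=
  Tendsto.comp h ((tendsto_const_nhds (x := x)).prodMk
    ((tendsto_const_nhds (x := v)).prodMk tendsto_id))

lemma tendsto_add_smul_nhds [ContinuousAdd E] [ContinuousSMul ℝ E] (x v : E) :
    Tendsto (fun p : E × E × ℝ => p.1 + p.2.2 • p.2.1) (𝓝 x ×ˢ 𝓝 v ×ˢ 𝓝[≠] 0) (𝓝 x) := by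
  have h : Continuous fun p : E × E × ℝ => p.1 + p.2.2 • p.2.1 := by fun_prop
  have h' := h.tendsto (x, v, 0)
  simp only [zero_smul, add_zero, nhds_prod_eq] at h'
  exact h'.mono_left (prod_mono le_rfl (prod_mono le_rfl nhdsWithin_le_nhds))

lemma tendsto_fst_nhds (x v : E) :
    Tendsto (fun p : E × E × ℝ => p.1) (𝓝 x ×ˢ 𝓝 v ×ˢ 𝓝[≠] 0) (𝓝 x) := tendsto_fst

lemma eventually_ne_zero (x v : E) :
    ∀ᶠ p : E × E × ℝ in 𝓝 x ×ˢ 𝓝 v ×ˢ 𝓝[≠] 0, p.2.2 ≠ 0 :=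
  (tendsto_snd.comp tendsto_snd).eventually (self_mem_nhdsWithin : {(0 : ℝ)}ᶜ ∈ 𝓝[≠] 0)

lemma HasStrictDirDeriv.congr [ContinuousAdd E] [ContinuousSMul ℝ E] {f g : E → F} {x v : E}
    {w : F} (h : HasStrictDirDeriv f x v w) (e : f =ᶠ[𝓝 x] g) : HasStrictDirDeriv g x v w := by
  refine Tendsto.congr' ?_ h
  filter_upwards [(tendsto_add_smul_nhds x v).eventually e, (tendsto_fst_nhds x v).eventually e]
    with p h1 h2
  rw [h1, h2]

/-- The difference quotient of `f` serves as the moving direction, and `f` of the base point as the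
moving base point, in the difference quotient of `g`. Convergence that is joint in base point,
direction and increment is exactly what this substitution requires. -/
lemma HasStrictDirDeriv.comp {g : F → G} {f : E → F} {x v : E} {w : F} {z : G}
    (hg : HasStrictDirDeriv g (f x) w z) (hf : HasStrictDirDeriv f x v w)
    (hc : ContinuousAt f x) : HasStrictDirDeriv (g ∘ f) x v z := by
  have h : Tendsto (fun p : E × E × ℝ =>
      (f p.1, p.2.2⁻¹ • (f (p.1 + p.2.2 • p.2.1) - f p.1), p.2.2))
      (𝓝 x ×ˢ 𝓝 v ×ˢ 𝓝[≠] 0) (𝓝 (f x) ×ˢ 𝓝 w ×ˢ 𝓝[≠] 0) :=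
    (hc.tendsto.comp (tendsto_fst_nhds x v)).prodMk
      (Tendsto.prodMk hf (tendsto_snd.comp tendsto_snd))
  refine (Tendsto.comp hg h).congr' ?_
  filter_upwards [eventually_ne_zero x v] with p hp
  simp [smul_smul, hp]

lemma HasStrictDirDeriv.prodMk {g : E → G} {f : E → F} {x v : E} {w : F} {z : G}
    (hf : HasStrictDirDeriv f x v w) (hg : HasStrictDirDeriv g x v z) :
    HasStrictDirDeriv (fun y => (f y, g y)) x v (w, z) := by
  rw [HasStrictDirDeriv, nhds_prod_eq]
  exact Tendsto.prodMk hf hg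

lemma ContinuousLinearMap.hasStrictDirDeriv_add_const (L : E →L[ℝ] F) (b : F) (x v : E) :
    HasStrictDirDeriv (fun y => L y + b) x v (L v) := by
  have h : Tendsto (fun p : E × E × ℝ => L p.2.1) (𝓝 x ×ˢ 𝓝 v ×ˢ 𝓝[≠] 0) (𝓝 (L v)) :=
    (L.continuous.tendsto v).comp (tendsto_fst.comp tendsto_snd)
  refine h.congr' ?_
  filter_upwards [eventually_ne_zero x v] with p hp
  simp [smul_smul, hp]

lemma ContinuousLinearMap.hasStrictDirDeriv (L : E →L[ℝ] F) (x v : E) :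
    HasStrictDirDeriv L x v (L v) := by
  simpa using ContinuousLinearMap.hasStrictDirDeriv_add_const L 0 x v

lemma HasStrictDirDeriv.unique [T2Space F] {f : E → F} {x v : E} {w z : F}
    (h : HasStrictDirDeriv f x v w) (h' : HasStrictDirDeriv f x v z) : w = z :=
  tendsto_nhds_unique h.hasDirDeriv h'.hasDirDeriv

/-- The induction quantifies over all domains `E`, here and below, because the derivative of a map
on `E` lives on `E × E`. -/
lemma StrictCkOn.ckOn {F : Type w} [AddCommGroup F] [Module ℝ F] [TopologicalSpace F] (k : ℕ) :
    ∀ {E : Type u} [AddCommGroup E] [Module ℝ E] [TopologicalSpace E] {f : E → F} {s : Set E},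
      StrictCkOn k f s → CkOn k f s := by
  induction k with
  | zero => intro E _ _ _ f s h; exact h
  | succ k ih =>
    rintro E _ _ _ f s ⟨h, f', h1, h2⟩
    exact ⟨h, f', fun x hx v => (h1 x hx v).hasDirDeriv, ih h2⟩

lemma StrictCkOn.continuousOn {k : ℕ} {f : E → F} {s : Set E} (h : StrictCkOn k f s) :
    ContinuousOn f s := by
  cases k with
  | zero => exact h
  | succ k => exact h.1

lemma StrictCkOn.mono {F : Type w} [AddCommGroup F] [Module ℝ F] [TopologicalSpace F] (k : ℕ) :
    ∀ {E : Type u} [AddCommGroup E] [Module ℝ E] [TopologicalSpace E] {f : E → F} {s t : Set E},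
      StrictCkOn k f s → t ⊆ s → StrictCkOn k f t := by
  induction k with
  | zero => intro E _ _ _ f s t h ht; exact ContinuousOn.mono h ht
  | succ k ih =>
    rintro E _ _ _ f s t ⟨h, f', h1, h2⟩ ht
    exact ⟨h.mono ht, f', fun x hx v => h1 x (ht hx) v, ih h2 (prod_mono ht le_rfl)⟩

lemma StrictCkOn.of_succ {F : Type w} [AddCommGroup F] [Module ℝ F] [TopologicalSpace F] (k : ℕ) :
    ∀ {E : Type u} [AddCommGroup E] [Module ℝ E] [TopologicalSpace E] {f : E → F} {s : Set E},
      StrictCkOn (k + 1) f s → StrictCkOn k f s := by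
  induction k with
  | zero => intro E _ _ _ f s h; exact h.1
  | succ k ih =>
    rintro E _ _ _ f s ⟨h, f', h1, h2⟩
    exact ⟨h, f', h1, ih h2⟩

lemma StrictCkOn.prodMk {F : Type w} [AddCommGroup F] [Module ℝ F] [TopologicalSpace F]
    {G : Type*} [AddCommGroup G] [Module ℝ G] [TopologicalSpace G] (k : ℕ) :
    ∀ {E : Type u} [AddCommGroup E] [Module ℝ E] [TopologicalSpace E] {f : E → F} {g : E → G}
      {s : Set E}, StrictCkOn k f s → StrictCkOn k g s →
        StrictCkOn k (fun x => (f x, g x)) s := by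
  induction k with
  | zero => intro E _ _ _ f g s hf hg; exact ContinuousOn.prodMk hf hg
  | succ k ih =>
    rintro E _ _ _ f g s ⟨hf, f', hf1, hf2⟩ ⟨hg, g', hg1, hg2⟩
    exact ⟨hf.prodMk hg, _, fun x hx v => (hf1 x hx v).prodMk (hg1 x hx v), ih hf2 hg2⟩

lemma ContinuousLinearMap.strictCkOn_add_const {F : Type w} [AddCommGroup F] [Module ℝ F]
    [TopologicalSpace F] [ContinuousAdd F] (k : ℕ) :
    ∀ {E : Type u} [AddCommGroup E] [Module ℝ E] [TopologicalSpace E] (L : E →L[ℝ] F) (b : F)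
      (s : Set E), StrictCkOn k (fun x => L x + b) s := by
  induction k with
  | zero =>
    intro E _ _ _ L b s
    exact (L.continuous.add continuous_const).continuousOn
  | succ k ih =>
    intro E _ _ _ L b s
    refine ⟨(L.continuous.add continuous_const).continuousOn, fun p => L p.2,
      fun x _ v => ContinuousLinearMap.hasStrictDirDeriv_add_const L b x v, ?_⟩
    simpa using ih (L.comp (ContinuousLinearMap.snd ℝ E E)) 0 (s ×ˢ univ)

lemma ContinuousLinearMap.strictCkOn (k : ℕ) :
    ∀ {E : Type u} [AddCommGroup E] [Module ℝ E] [TopologicalSpace E]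
      {F : Type w} [AddCommGroup F] [Module ℝ F] [TopologicalSpace F] (L : E →L[ℝ] F)
      (s : Set E), StrictCkOn k L s := by
  induction k with
  | zero =>
    intro E _ _ _ F _ _ _ L s
    exact L.continuous.continuousOn
  | succ k ih =>
    intro E _ _ _ F _ _ _ L s
    exact ⟨L.continuous.continuousOn, fun p => L p.2,
      fun x _ v => ContinuousLinearMap.hasStrictDirDeriv L x v,
      ih (L.comp (ContinuousLinearMap.snd ℝ E E)) (s ×ˢ univ)⟩

/-- Separate from the general chain rule, whose proof uses the case of the projection `E × E → E`. A
linear inner map is continuous everywhere, so no openness is needed. -/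
lemma StrictCkOn.comp_clm {G : Type*} [AddCommGroup G] [Module ℝ G] [TopologicalSpace G] (k : ℕ) :
    ∀ {F : Type w} [AddCommGroup F] [Module ℝ F] [TopologicalSpace F]
      {E : Type u} [AddCommGroup E] [Module ℝ E] [TopologicalSpace E] {g : F → G} {t : Set F}
      (L : E →L[ℝ] F), StrictCkOn k g t → StrictCkOn k (fun x => g (L x)) (L ⁻¹' t) := by
  induction k with
  | zero =>
    intro F _ _ _ E _ _ _ g t L hg
    exact ContinuousOn.comp hg L.continuous.continuousOn fun x hx => hx
  | succ k ih =>
    rintro F _ _ _ E _ _ _ g t L ⟨hg, g', hg1, hg2⟩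
    exact ⟨hg.comp L.continuous.continuousOn fun x hx => hx, fun p => g' (L p.1, L p.2),
      fun x hx v => (hg1 _ hx _).comp (ContinuousLinearMap.hasStrictDirDeriv L x v)
        L.continuous.continuousAt, (ih (L.prodMap L) hg2).mono k fun p hp => ⟨hp.1, mem_univ _⟩⟩

/-- The derivative of the composite is `g'` after `(x, v) ↦ (f x, f' (x, v))`. At order `k + 1` all
three ingredients are of class `k`, once one order of `f` is given up. -/
lemma StrictCkOn.comp {G : Type*} [AddCommGroup G] [Module ℝ G] [TopologicalSpace G] (k : ℕ) :
    ∀ {F : Type w} [AddCommGroup F] [Module ℝ F] [TopologicalSpace F]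
      {E : Type u} [AddCommGroup E] [Module ℝ E] [TopologicalSpace E] {f : E → F} {g : F → G}
      {s : Set E} {t : Set F}, IsOpen s → StrictCkOn k g t → StrictCkOn k f s → MapsTo f s t →
        StrictCkOn k (g ∘ f) s := by
  induction k with
  | zero => intro F _ _ _ E _ _ _ f g s t hs hg hf h; exact ContinuousOn.comp hg hf h
  | succ k ih =>
    rintro F _ _ _ E _ _ _ f g s t hs hg hf h
    have hf' := hf.of_succ
    obtain ⟨hg, g', hg1, hg2⟩ := hg
    obtain ⟨hf, f', hf1, hf2⟩ := hf
    refine ⟨hg.comp hf h, g' ∘ fun p : E × E => (f p.1, f' p), fun x hx v => ?_, ?_⟩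
    · exact (hg1 _ (h hx) _).comp (hf1 x hx v) (hf.continuousAt (hs.mem_nhds hx))
    · have h1 : StrictCkOn k (f ∘ Prod.fst : E × E → F) (s ×ˢ univ) :=
        (hf'.comp_clm k (ContinuousLinearMap.fst ℝ E E)).mono k fun p hp => hp.1
      exact ih (hs.prod isOpen_univ) hg2 (h1.prodMk k hf2) fun p hp => ⟨h hp.1, mem_univ _⟩

lemma StrictCkOn.congr {k : ℕ} {f g : E → F} {s : Set E} [ContinuousAdd E] [ContinuousSMul ℝ E]
    (hf : StrictCkOn k f s) (hs : IsOpen s) (h : EqOn f g s) : StrictCkOn k g s := by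
  cases k with
  | zero => exact ContinuousOn.congr hf h.symm
  | succ k =>
    obtain ⟨hf, f', hf1, hf2⟩ := hf
    exact ⟨hf.congr h.symm, f', fun x hx v =>
      (hf1 x hx v).congr (eventually_of_mem (hs.mem_nhds hx) h), hf2⟩

/-- Derivatives found on different neighbourhoods agree where they overlap, limits in `F` being
unique. Hence evaluating at `(x, v)` the derivative attached to the neighbourhood of `x` gives a
globally coherent choice. -/
lemma StrictCkOn.of_locally {F : Type w} [AddCommGroup F] [Module ℝ F] [TopologicalSpace F]
    [T2Space F] (k : ℕ) :
    ∀ {E : Type u} [AddCommGroup E] [Module ℝ E] [TopologicalSpace E] [ContinuousAdd E]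
      [ContinuousSMul ℝ E] {f : E → F} {s : Set E}, IsOpen s →
      (∀ x ∈ s, ∃ t, IsOpen t ∧ x ∈ t ∧ StrictCkOn k f t) → StrictCkOn k f s := by
  induction k with
  | zero =>
    intro E _ _ _ _ _ f s _ h x hx
    obtain ⟨t, ht, hxt, hf⟩ := h x hx
    exact (hf.continuousOn.continuousAt (ht.mem_nhds hxt)).continuousWithinAt
  | succ k ih =>
    intro E _ _ _ _ _ f s hs h
    choose! t ht hxt hf f' hf1 hf2 using h
    refine ⟨fun x hx => ((hf x hx).continuousAt ((ht x hx).mem_nhds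
      (hxt x hx))).continuousWithinAt, fun p => f' p.1 p,
      fun x hx v => hf1 x hx x (hxt x hx) v, ih (hs.prod isOpen_univ) fun p hp => ?_⟩
    have ho : IsOpen ((t p.1 ∩ s) ×ˢ (univ : Set E)) :=
      ((ht _ hp.1).inter hs).prod isOpen_univ
    refine ⟨_, ho, ⟨⟨hxt _ hp.1, hp.1⟩, mem_univ _⟩, StrictCkOn.congr ((hf2 p.1 hp.1).mono k
      (prod_mono inter_subset_left le_rfl)) ho fun q hq => ?_⟩
    exact (hf1 p.1 hp.1 q.1 hq.1.1 q.2).unique (hf1 q.1 hq.1.2 q.1 (hxt _ hq.1.2) q.2)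

end Calculus

/-! ### The Fréchet space of smooth functions -/

section FrechetSpace

variable {n : ℕ} {M : Type u} [TopologicalSpace M] [ChartedSpace (EuclideanSpace ℝ (Fin n)) M]
  [IsManifold (𝓡 n) ∞ M]
  {V : Type} [NormedAddCommGroup V] [NormedSpace ℝ V]
  {W : Type} [NormedAddCommGroup W] [NormedSpace ℝ W]

lemma SmoothFun.mdifferentiableAt (f : SmoothFun n M V) (x : M) :
    MDifferentiableAt (𝓡 n) 𝓘(ℝ, V) f x :=
  f.contMDiff.mdifferentiable (by simp) x

/-- The derivative is the fibre component of the tangent map of `f` along the section `X`; at order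
`∞` nothing is lost by differentiating. -/
lemma contMDiff_derivAlong (X : SmoothVectorField n M) (f : SmoothFun n M V) :
    ContMDiff (𝓡 n) 𝓘(ℝ, V) ∞ (derivAlong X f) := by
  have h1 := f.contMDiff.contMDiff_tangentMap (m := ∞) le_rfl
  have h2 := (contMDiff_snd_tangentBundle_modelSpace V 𝓘(ℝ, V) (n := ∞)).comp
    (h1.comp X.contMDiff)
  exact h2

/-- The derivative along a vector field as a linear operator on smooth functions. -/
def derivOp (X : SmoothVectorField n M) : SmoothFun n M V →ₗ[ℝ] SmoothFun n M V where
  toFun f := ⟨derivAlong X f, contMDiff_derivAlong X f⟩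
  map_add' f g := by
    ext x
    change mfderiv (𝓡 n) 𝓘(ℝ, V) (f + g : M → V) x (X x) = _
    rw [mfderiv_add (f.mdifferentiableAt x) (g.mdifferentiableAt x)]
    rfl
  map_smul' r f := by
    ext x
    change mfderiv (𝓡 n) 𝓘(ℝ, V) (r • f : M → V) x (X x) = _
    rw [const_smul_mfderiv (f.mdifferentiableAt x)]
    rfl

/-- The iterated derivative as a linear operator on smooth functions. -/
def iterDerivOp (Xs : List (SmoothVectorField n M)) : SmoothFun n M V →ₗ[ℝ] SmoothFun n M V :=
  Xs.foldr (fun X L => derivOp X ∘ₗ L) LinearMap.id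

@[simp] lemma iterDerivOp_nil : iterDerivOp (V := V) ([] : List (SmoothVectorField n M)) =
    LinearMap.id := rfl

lemma iterDerivOp_cons (X : SmoothVectorField n M) (Xs : List (SmoothVectorField n M))
    (f : SmoothFun n M V) : iterDerivOp (X :: Xs) f = derivOp X (iterDerivOp Xs f) := rfl

/-- The last field of a list acts first. Inductions below peel off this innermost field, since the
chain rule can be applied only there. -/
lemma iterDerivOp_concat (X : SmoothVectorField n M) (Xs : List (SmoothVectorField n M))
    (f : SmoothFun n M V) : iterDerivOp (Xs ++ [X]) f = iterDerivOp Xs (derivOp X f) := by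
  induction Xs with
  | nil => rfl
  | cons Y Ys ih => rw [List.cons_append, iterDerivOp_cons, ih, iterDerivOp_cons]

lemma coe_iterDerivOp (Xs : List (SmoothVectorField n M)) (f : SmoothFun n M V) :
    ⇑(iterDerivOp Xs f) = iterDerivAlong Xs f := by
  induction Xs with
  | nil => rfl
  | cons X Xs ih =>
    change derivAlong X (iterDerivOp Xs f) = derivAlong X (iterDerivAlong Xs f)
    rw [ih]

/-- A smooth function as a continuous function. -/
def toContinuous : SmoothFun n M V →ₗ[ℝ] C(M, V) where
  toFun f := ⟨f, f.contMDiff.continuous⟩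
  map_add' _ _ := rfl
  map_smul' _ _ := rfl

@[simp] lemma toContinuous_apply (f : SmoothFun n M V) (x : M) : toContinuous f x = f x := rfl

lemma mfderiv_comp_fderiv {g : V → W} {f : SmoothFun n M V} {x : M}
    (hg : DifferentiableAt ℝ g (f x)) (v : TangentSpace (𝓡 n) x) :
    (mfderiv (𝓡 n) 𝓘(ℝ, W) (fun y => g (f y)) x v : W) =
      fderiv ℝ g (f x) (mfderiv (𝓡 n) 𝓘(ℝ, V) f x v : V) := by
  have h := mfderiv_comp x (I := 𝓡 n) (I' := 𝓘(ℝ, V)) (I'' := 𝓘(ℝ, W)) (f := f) (g := g)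
    hg.mdifferentiableAt (f.mdifferentiableAt x)
  rw [mfderiv_eq_fderiv] at h
  exact DFunLike.congr_fun h v

/-- Composition with a continuous linear map, as a linear operator. -/
def compLin (L : V →L[ℝ] W) : SmoothFun n M V →ₗ[ℝ] SmoothFun n M W where
  toFun f := ⟨fun x => L (f x), (L.contDiff.contMDiff.comp f.contMDiff :)⟩
  map_add' f g := by ext x; exact map_add L _ _
  map_smul' r f := by ext x; exact map_smul L _ _

@[simp] lemma compLin_apply (L : V →L[ℝ] W) (f : SmoothFun n M V) (x : M) :
    compLin L f x = L (f x) := rfl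

lemma derivOp_compLin (L : V →L[ℝ] W) (X : SmoothVectorField n M) (f : SmoothFun n M V) :
    derivOp X (compLin L f) = compLin L (derivOp X f) := by
  ext x
  exact (mfderiv_comp_fderiv L.differentiableAt (X x)).trans (by rw [L.fderiv]; rfl)

lemma iterDerivOp_compLin (L : V →L[ℝ] W) (Xs : List (SmoothVectorField n M))
    (f : SmoothFun n M V) : iterDerivOp Xs (compLin L f) = compLin L (iterDerivOp Xs f) := by
  induction Xs with
  | nil => rfl
  | cons X Xs ih => rw [iterDerivOp_cons, iterDerivOp_cons, ih, derivOp_compLin]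

/-- The constant functions, as a linear operator. -/
def constLin : V →ₗ[ℝ] SmoothFun n M V where
  toFun v := ⟨fun _ => v, contMDiff_const⟩
  map_add' _ _ := rfl
  map_smul' _ _ := rfl

lemma derivOp_constLin (X : SmoothVectorField n M) (v : V) : derivOp X (constLin v) = 0 := by
  ext x
  change mfderiv (𝓡 n) 𝓘(ℝ, V) (fun _ => v) x (X x) = 0
  rw [mfderiv_const]
  rfl

variable [CompactSpace M]

/-- On a compact space the topology of `C(M, V)` is that of uniform convergence. In this form the
Fréchet topology is initial for linear maps into topological vector spaces, so the vector space
axioms are inherited. -/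
lemma frechetTopology_eq : (frechetTopology : TopologicalSpace (SmoothFun n M V)) =
    ⨅ Xs : List (SmoothVectorField n M),
      TopologicalSpace.induced (toContinuous ∘ₗ iterDerivOp Xs) inferInstance := by
  unfold frechetTopology
  refine iInf_congr fun Xs => ?_
  have h := congrArg (TopologicalSpace.induced (toContinuous ∘ₗ iterDerivOp (V := V) Xs))
    (ContinuousMap.isUniformEmbedding_uniformFunOfFun (α := M) (β := V)).isInducing.eq_induced
  rw [induced_compose] at h
  refine Eq.trans ?_ h.symm
  congr 1
  ext f : 1
  exact congrArg UniformFun.ofFun (coe_iterDerivOp Xs f).symm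

instance : IsTopologicalAddGroup (SmoothFun n M V) := by
  rw [frechetTopology_eq]
  exact topologicalAddGroup_iInf fun Xs => topologicalAddGroup_induced _

instance : ContinuousSMul ℝ (SmoothFun n M V) := by
  rw [frechetTopology_eq]
  exact continuousSMul_iInf fun Xs => continuousSMul_induced _

lemma tendsto_smoothFun_iff {ι : Type*} {F : ι → SmoothFun n M V} {l : Filter ι}
    {f : SmoothFun n M V} : Tendsto F l (𝓝 f) ↔ ∀ Xs : List (SmoothVectorField n M),
      Tendsto (fun i => toContinuous (iterDerivOp Xs (F i))) l
        (𝓝 (toContinuous (iterDerivOp Xs f))) := by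
  rw [frechetTopology_eq, nhds_iInf, tendsto_iInf]
  refine forall_congr' fun Xs => ?_
  rw [nhds_induced, tendsto_comap_iff]
  rfl

lemma continuous_toContinuous_iterDerivOp (Xs : List (SmoothVectorField n M)) :
    Continuous fun f : SmoothFun n M V => toContinuous (iterDerivOp Xs f) :=
  continuous_iff_continuousAt.2 fun _ => tendsto_smoothFun_iff.1 tendsto_id Xs

lemma continuous_toContinuous : Continuous (toContinuous : SmoothFun n M V → C(M, V)) :=
  continuous_toContinuous_iterDerivOp []

lemma continuous_smoothFun_iff {X : Type*} [TopologicalSpace X] {F : X → SmoothFun n M V} :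
    Continuous F ↔ ∀ Xs : List (SmoothVectorField n M),
      Continuous fun i => toContinuous (iterDerivOp Xs (F i)) := by
  simp_rw [continuous_iff_continuousAt]
  exact ⟨fun h Xs x => tendsto_smoothFun_iff.1 (h x) Xs,
    fun h x => tendsto_smoothFun_iff.2 fun Xs => h Xs x⟩

lemma tendsto_eval {ι : Type*} {l : Filter ι} {F : ι → SmoothFun n M V} {f : SmoothFun n M V}
    {p : ι → M} {x : M} (hF : Tendsto F l (𝓝 f)) (hp : Tendsto p l (𝓝 x)) :
    Tendsto (fun i => F i (p i)) l (𝓝 (f x)) := by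
  have h : Continuous fun q : C(M, V) × M => q.1 q.2 := continuous_eval
  exact (h.tendsto (toContinuous f, x)).comp
    ((((continuous_toContinuous.tendsto f).comp hF)).prodMk_nhds hp)

instance : T2Space (SmoothFun n M V) :=
  T2Space.of_injective_continuous (f := (toContinuous : SmoothFun n M V → C(M, V)))
    (fun f g h => by ext x; exact congrArg (fun k : C(M, V) => k x) h) continuous_toContinuous

/-- The derivative along a vector field is continuous. -/
lemma continuous_derivOp (X : SmoothVectorField n M) :
    Continuous (derivOp X : SmoothFun n M V → SmoothFun n M V) := by
  refine continuous_smoothFun_iff.2 fun Xs => ?_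
  simpa only [iterDerivOp_concat] using continuous_toContinuous_iterDerivOp (V := V) (Xs ++ [X])

/-- Joint convergence implies convergence of continuous functions on a compact space. -/
lemma tendsto_continuousMap_of_joint {ι : Type*} {l : Filter ι} {F : ι → C(M, V)} {f : C(M, V)}
    (h : ∀ x, Tendsto (fun p : ι × M => F p.1 p.2) (l ×ˢ 𝓝 x) (𝓝 (f x))) :
    Tendsto F l (𝓝 f) := by
  rw [ContinuousMap.tendsto_iff_tendstoUniformly,
    ← tendstoLocallyUniformly_iff_tendstoUniformly_of_compactSpace,
    tendstoLocallyUniformly_iff_filter]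
  intro x u hu
  have h1 : Tendsto (fun p : ι × M => f p.2) (l ×ˢ 𝓝 x) (𝓝 (f x)) :=
    (f.continuous.tendsto x).comp tendsto_snd
  have h2 := h1.prodMk_nhds (h x)
  exact h2.eventually (nhds_prod_eq (x := f x) (y := f x) ▸ nhds_le_uniformity _ hu)

/-! ### Continuous linear operators on smooth functions -/

/-- Composition with a continuous linear map, as a continuous linear operator. -/
def compL (L : V →L[ℝ] W) : SmoothFun n M V →L[ℝ] SmoothFun n M W where
  toLinearMap := compLin L
  cont := by
    refine continuous_smoothFun_iff.2 fun Xs => ?_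
    have h : Continuous fun f : C(M, V) => (ContinuousMap.mk L L.continuous).comp f :=
      ContinuousMap.continuous_postcomp _
    refine (h.comp (continuous_toContinuous_iterDerivOp Xs)).congr fun f => ?_
    ext x
    exact (DFunLike.congr_fun (iterDerivOp_compLin L Xs f) x).symm

@[simp] lemma compL_apply (L : V →L[ℝ] W) (f : SmoothFun n M V) (x : M) :
    compL L f x = L (f x) := rfl

/-- The constant functions, as a continuous linear operator. -/
def constL : V →L[ℝ] SmoothFun n M V where
  toLinearMap := constLin
  cont := by
    refine continuous_smoothFun_iff.2 fun Xs => ?_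
    -- Every nonempty list of fields kills constants, already through its innermost field.
    rcases List.eq_nil_or_concat Xs with rfl | ⟨Ys, X, rfl⟩
    · exact ContinuousMap.continuous_const'
    · refine continuous_const.congr (f := fun _ => (0 : C(M, V))) fun v => ?_
      have h : iterDerivOp (Ys.concat X) (constLin v : SmoothFun n M V) = 0 := by
        rw [List.concat_eq_append, iterDerivOp_concat, derivOp_constLin, map_zero]
      exact ((congrArg toContinuous h).trans (map_zero _)).symm

@[simp] lemma constL_apply (v : V) (x : M) : constL (n := n) v x = v := rfl

/-- A pair of functions as a function with values in the product. -/
def pairL : SmoothFun n M V × SmoothFun n M W →L[ℝ] SmoothFun n M (V × W) :=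
  (compL (ContinuousLinearMap.inl ℝ V W)).coprod (compL (ContinuousLinearMap.inr ℝ V W))

@[simp] lemma pairL_apply (f : SmoothFun n M V) (g : SmoothFun n M W) (x : M) :
    pairL (f, g) x = (f x, g x) := by
  change (f x, 0) + (0, g x) = _
  simp

lemma derivOp_pairL (X : SmoothVectorField n M) (f : SmoothFun n M V) (g : SmoothFun n M W) :
    derivOp X (pairL (f, g)) = pairL (derivOp X f, derivOp X g) := by
  change derivOp X (compLin (.inl ℝ V W) f + compLin (.inr ℝ V W) g) =
    compLin (.inl ℝ V W) (derivOp X f) + compLin (.inr ℝ V W) (derivOp X g)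
  rw [map_add, derivOp_compLin, derivOp_compLin]

variable [MeasurableSpace M] [BorelSpace M] (μ : Measure M) [IsFiniteMeasure μ]

/-- Integration as a continuous linear functional. -/
def integralL [CompleteSpace V] : SmoothFun n M V →L[ℝ] V where
  toFun f := ∫ x, f x ∂μ
  map_add' f g := integral_add (integrable_fun μ f) (integrable_fun μ g)
  map_smul' r f := integral_smul (μ := μ) r (fun x => f x)
  cont := by
    have h : Continuous fun f : C(M, V) => ∫ x, f x ∂μ := by
      refine continuous_of_linear_of_bound (𝕜 := ℝ)
        (fun f g => integral_add (integrable_of_continuous μ f.continuous)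
          (integrable_of_continuous μ g.continuous))
        (fun r f => integral_smul (μ := μ) r (fun x => f x)) (C := μ.real univ) fun f => ?_
      rw [mul_comm]
      exact norm_integral_le_of_norm_le_const (Eventually.of_forall f.norm_coe_le_norm)
    exact h.comp continuous_toContinuous

@[simp] lemma integralL_apply [CompleteSpace V] (f : SmoothFun n M V) :
    integralL μ f = ∫ x, f x ∂μ := rfl

end FrechetSpace

/-! ### Composition operators between spaces of smooth functions -/

section CompositionOperators

variable {n : ℕ} {M : Type u} [TopologicalSpace M] [ChartedSpace (EuclideanSpace ℝ (Fin n)) M]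
  [IsManifold (𝓡 n) ∞ M]
  {V : Type} [NormedAddCommGroup V] [NormedSpace ℝ V]
  {W : Type} [NormedAddCommGroup W] [NormedSpace ℝ W]

open Classical in
/-- The composition operator `f ↦ g ∘ f` (with value zero where `g ∘ f` is not smooth). -/
def compOp (g : V → W) (f : SmoothFun n M V) : SmoothFun n M W :=
  if h : ContMDiff (𝓡 n) 𝓘(ℝ, W) ∞ (fun x => g (f x)) then ⟨fun x => g (f x), h⟩ else 0

variable (n M) in
/-- The smooth functions with values in `U`. -/
def valuesIn (U : Set V) : Set (SmoothFun n M V) := {f | ∀ x, f x ∈ U}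

/-- The derivative of `g` as a function of the base point and the direction. -/
def totalDeriv (g : V → W) (p : V × V) : W := fderiv ℝ g p.1 p.2

variable {g : V → W} {U : Set V}

lemma compOp_apply (hU : IsOpen U) (hg : ContDiffOn ℝ ∞ g U) {f : SmoothFun n M V}
    (hf : f ∈ valuesIn n M U) (x : M) : compOp g f x = g (f x) := by
  have h : ContMDiff (𝓡 n) 𝓘(ℝ, W) ∞ (fun x => g (f x)) := fun x =>
    (hg.contDiffAt (hU.mem_nhds (hf x))).contMDiffAt.comp x (f.contMDiff x)
  exact congrArg (fun F : SmoothFun n M W => F x) (dif_pos h)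

lemma contDiffOn_totalDeriv (hU : IsOpen U) (hg : ContDiffOn ℝ ∞ g U) :
    ContDiffOn ℝ ∞ (totalDeriv g) (U ×ˢ univ) := by
  have h : ContDiffOn ℝ ∞ (fderiv ℝ g) U := hg.fderiv_of_isOpen hU (by simp)
  exact (h.comp contDiff_fst.contDiffOn fun p hp => hp.1).clm_apply contDiff_snd.contDiffOn

lemma totalDeriv_totalDeriv (hU : IsOpen U) (hg : ContDiffOn ℝ ∞ g U) {a : V} (ha : a ∈ U)
    (b c d : V) : totalDeriv (totalDeriv g) ((a, b), (c, d)) =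
      fderiv ℝ (fderiv ℝ g) a c b + fderiv ℝ g a d := by
  have h : DifferentiableAt ℝ (fderiv ℝ g) a :=
    ((hg.fderiv_of_isOpen hU (by simp : (∞ : WithTop ℕ∞) + 1 ≤ ∞)).contDiffAt
      (hU.mem_nhds ha)).differentiableAt (by simp)
  have h1 : HasFDerivAt (fun p : V × V => fderiv ℝ g p.1)
      ((fderiv ℝ (fderiv ℝ g) a).comp (ContinuousLinearMap.fst ℝ V V)) (a, b) :=
    HasFDerivAt.comp (a, b) (f := Prod.fst) h.hasFDerivAt hasFDerivAt_fst
  have h2 := h1.clm_apply (hasFDerivAt_snd (𝕜 := ℝ) (p := (a, b)))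
  change fderiv ℝ (fun p : V × V => fderiv ℝ g p.1 p.2) (a, b) (c, d) = _
  rw [h2.fderiv]
  simp [add_comm]

/-- Symmetry of the second derivative, as the flip of the double tangent space. It will say that
differentiating along a vector field commutes with varying the function. -/
lemma totalDeriv_totalDeriv_symm (hU : IsOpen U) (hg : ContDiffOn ℝ ∞ g U) {a : V} (ha : a ∈ U)
    (b c d : V) : totalDeriv (totalDeriv g) ((a, b), (c, d)) =
      totalDeriv (totalDeriv g) ((a, c), (b, d)) := by
  rw [totalDeriv_totalDeriv hU hg ha, totalDeriv_totalDeriv hU hg ha]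
  congr 1
  exact ((hg.contDiffAt (hU.mem_nhds ha)).isSymmSndFDerivAt
    (by simpa using WithTop.coe_le_coe.2 (le_top : (2 : ℕ∞) ≤ ⊤))).eq c b

variable [CompactSpace M]

lemma isOpen_valuesIn (hU : IsOpen U) : IsOpen (valuesIn n M U) := by
  have h : IsOpen {f : C(M, V) | MapsTo f univ U} :=
    ContinuousMap.isOpen_setOfPred_mapsTo isCompact_univ hU
  convert h.preimage (continuous_toContinuous (n := n)) using 1
  ext f
  simp [valuesIn, MapsTo]

lemma pairL_mem_valuesIn {f : SmoothFun n M V} (hf : f ∈ valuesIn n M U) (h : SmoothFun n M V) :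
    pairL (f, h) ∈ valuesIn n M (U ×ˢ (univ : Set V)) := fun x => by
  rw [pairL_apply]
  exact ⟨hf x, mem_univ _⟩

/-- One field derivative is traded for the passage from `g` to `totalDeriv g`: this is the reduction
step of all inductions on the number of fields. -/
lemma derivOp_compOp (hU : IsOpen U) (hg : ContDiffOn ℝ ∞ g U) {f : SmoothFun n M V}
    (hf : f ∈ valuesIn n M U) (X : SmoothVectorField n M) :
    derivOp X (compOp g f) = compOp (totalDeriv g) (pairL (f, derivOp X f)) := by
  ext x
  rw [compOp_apply (hU.prod isOpen_univ) (contDiffOn_totalDeriv hU hg) (pairL_mem_valuesIn hf _),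
    pairL_apply]
  have e : ⇑(compOp g f) = fun x => g (f x) := funext (compOp_apply hU hg hf)
  change mfderiv (𝓡 n) 𝓘(ℝ, W) (compOp g f) x (X x) = _
  rw [e]
  exact mfderiv_comp_fderiv ((hg.contDiffAt (hU.mem_nhds (hf x))).differentiableAt (by simp)) _

/-- The space `V` and the function `g` vary in the induction, because the reduction step replaces
them by `V × V` and `totalDeriv g`. -/
lemma continuousOn_iterDerivOp_compOp (k : ℕ) :
    ∀ {V : Type} [NormedAddCommGroup V] [NormedSpace ℝ V] {g : V → W} {U : Set V}
      (Xs : List (SmoothVectorField n M)), Xs.length = k → IsOpen U → ContDiffOn ℝ ∞ g U →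
      ContinuousOn (fun f : SmoothFun n M V => toContinuous (iterDerivOp Xs (compOp g f)))
        (valuesIn n M U) := by
  induction k with
  | zero =>
    intro V _ _ g U Xs hXs hU hg f hf
    obtain rfl := List.length_eq_zero_iff.1 hXs
    refine ContinuousAt.continuousWithinAt (tendsto_continuousMap_of_joint fun x => ?_)
    have h1 : Tendsto (fun p : SmoothFun n M V × M => p.1 p.2) (𝓝 f ×ˢ 𝓝 x) (𝓝 (f x)) :=
      tendsto_eval tendsto_fst tendsto_snd
    have h2 := ((hg.continuousOn.continuousAt (hU.mem_nhds (hf x))).tendsto).comp h1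
    simp only [iterDerivOp_nil, LinearMap.id_coe, id, toContinuous_apply]
    rw [compOp_apply hU hg hf]
    refine h2.congr' ?_
    filter_upwards [tendsto_fst.eventually ((isOpen_valuesIn hU).mem_nhds hf)] with p hp
    exact (compOp_apply hU hg hp _).symm
  | succ k ih =>
    intro V _ _ g U Xs hXs hU hg
    obtain rfl | ⟨Ys, X, rfl⟩ := List.eq_nil_or_concat Xs
    · simp at hXs
    · rw [List.concat_eq_append] at hXs ⊢
      have h := ih (g := totalDeriv g) (U := U ×ˢ (univ : Set V)) Ys (by simpa using hXs)
        (hU.prod isOpen_univ) (contDiffOn_totalDeriv hU hg)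
      have hc : Continuous fun f : SmoothFun n M V => pairL (f, derivOp X f) :=
        pairL.continuous.comp (continuous_id.prodMk (continuous_derivOp X))
      refine (h.comp hc.continuousOn fun f hf => pairL_mem_valuesIn hf _).congr fun f hf => ?_
      simp only [iterDerivOp_concat, derivOp_compOp hU hg hf, Function.comp_apply]

lemma continuousOn_compOp (hU : IsOpen U) (hg : ContDiffOn ℝ ∞ g U) :
    ContinuousOn (compOp g : SmoothFun n M V → SmoothFun n M W) (valuesIn n M U) := fun f hf =>
  tendsto_smoothFun_iff.2 fun Xs => continuousOn_iterDerivOp_compOp _ Xs rfl hU hg f hf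

/-- Strict differentiability of `g` at each value `f x` gives convergence jointly with the point of
`M`, and compactness makes this uniform. -/
lemma tendsto_toContinuous_slope_compOp (hU : IsOpen U) (hg : ContDiffOn ℝ ∞ g U)
    {f : SmoothFun n M V} (hf : f ∈ valuesIn n M U) (v : SmoothFun n M V) :
    Tendsto (fun p : SmoothFun n M V × SmoothFun n M V × ℝ =>
      toContinuous (p.2.2⁻¹ • (compOp g (p.1 + p.2.2 • p.2.1) - compOp g p.1)))
      (𝓝 f ×ˢ 𝓝 v ×ˢ 𝓝[≠] 0) (𝓝 (toContinuous (compOp (totalDeriv g) (pairL (f, v))))) := by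
  refine tendsto_continuousMap_of_joint fun x => ?_
  have hs := ((hg.contDiffAt (hU.mem_nhds (hf x))).hasStrictFDerivAt (by simp))
  set l : Filter ((SmoothFun n M V × SmoothFun n M V × ℝ) × M) :=
    (𝓝 f ×ˢ 𝓝 v ×ˢ 𝓝[≠] 0) ×ˢ 𝓝 x with hl
  have h0 : Tendsto (fun p : (SmoothFun n M V × SmoothFun n M V × ℝ) × M => p.1) l
    (𝓝 f ×ˢ 𝓝 v ×ˢ 𝓝[≠] 0) := tendsto_fst
  have h1 : Tendsto (fun p : (SmoothFun n M V × SmoothFun n M V × ℝ) × M => p.1.1 p.2) l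
      (𝓝 (f x)) := tendsto_eval (tendsto_fst.comp h0) tendsto_snd
  have h2 : Tendsto (fun p : (SmoothFun n M V × SmoothFun n M V × ℝ) × M => p.1.2.1 p.2) l
      (𝓝 (v x)) := tendsto_eval ((tendsto_fst.comp tendsto_snd).comp h0) tendsto_snd
  have h3 : Tendsto (fun p : (SmoothFun n M V × SmoothFun n M V × ℝ) × M =>
      (p.1.1 + p.1.2.2 • p.1.2.1) p.2) l (𝓝 (f x)) :=
    tendsto_eval ((tendsto_add_smul_nhds f v).comp h0) tendsto_snd
  have h4 : ∀ᶠ p : (SmoothFun n M V × SmoothFun n M V × ℝ) × M in l, p.1.2.2 ≠ 0 :=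
    h0.eventually (eventually_ne_zero f v)
  have ho := hs.isLittleO.comp_tendsto (h3.prodMk_nhds h1)
  -- The remainder is small relative to the increment, which is `t` times the value of the
  -- direction. Those values stay bounded near `x`, so division by `t` leaves a quantity tending to
  -- zero.
  have hb : (fun p : (SmoothFun n M V × SmoothFun n M V × ℝ) × M =>
      p.1.2.2⁻¹ • (g ((p.1.1 + p.1.2.2 • p.1.2.1) p.2) - g (p.1.1 p.2) -
        fderiv ℝ g (f x) ((p.1.1 + p.1.2.2 • p.1.2.1) p.2 - p.1.1 p.2))) =o[l]
      fun _ => (1 : ℝ) := by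
    have := (Asymptotics.isBigO_refl (fun p : (SmoothFun n M V × SmoothFun n M V × ℝ) × M =>
      p.1.2.2⁻¹) l).smul_isLittleO ho
    refine this.trans_isBigO ?_
    refine Asymptotics.IsBigO.congr' (h2.isBigO_one ℝ) ?_ EventuallyEq.rfl
    filter_upwards [h4] with p hp
    simp [smul_smul, hp]
  have hb' := (Asymptotics.isLittleO_one_iff ℝ).1 hb
  have h5 := hb'.add (((fderiv ℝ g (f x)).continuous.tendsto (v x)).comp h2)
  rw [toContinuous_apply, compOp_apply (hU.prod isOpen_univ) (contDiffOn_totalDeriv hU hg)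
    (pairL_mem_valuesIn hf _), pairL_apply]
  rw [zero_add] at h5
  refine h5.congr' ?_
  have hn := (isOpen_valuesIn (n := n) (M := M) hU).mem_nhds hf
  filter_upwards [h4, (tendsto_fst.comp h0).eventually hn,
    ((tendsto_add_smul_nhds f v).comp h0).eventually hn] with p hp hp1 hp2
  have e1 : compOp g p.1.1 p.2 = g (p.1.1 p.2) := compOp_apply hU hg hp1 _
  have e2 : compOp g (p.1.1 + p.1.2.2 • p.1.2.1) p.2 = _ := compOp_apply hU hg hp2 _
  change _ = p.1.2.2⁻¹ • (compOp g (p.1.1 + p.1.2.2 • p.1.2.1) p.2 - compOp g p.1.1 p.2)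
  rw [e1, e2, smul_sub]
  simp [smul_smul, hp]

/-- The innermost field turns the quotient of `g` at `f` in direction `v` into that of `totalDeriv
g` at `(f, X f)` in direction `(v, X v)`, to which the induction hypothesis applies. -/
lemma tendsto_slope_iterDerivOp_compOp (k : ℕ) :
    ∀ {V : Type} [NormedAddCommGroup V] [NormedSpace ℝ V] {g : V → W} {U : Set V}
      (Xs : List (SmoothVectorField n M)), Xs.length = k → IsOpen U → ContDiffOn ℝ ∞ g U →
      ∀ {f : SmoothFun n M V}, f ∈ valuesIn n M U → ∀ v : SmoothFun n M V,
      Tendsto (fun p : SmoothFun n M V × SmoothFun n M V × ℝ => toContinuous (iterDerivOp Xs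
        (p.2.2⁻¹ • (compOp g (p.1 + p.2.2 • p.2.1) - compOp g p.1))))
        (𝓝 f ×ˢ 𝓝 v ×ˢ 𝓝[≠] 0)
        (𝓝 (toContinuous (iterDerivOp Xs (compOp (totalDeriv g) (pairL (f, v)))))) := by
  induction k with
  | zero =>
    intro V _ _ g U Xs hXs hU hg f hf v
    obtain rfl := List.length_eq_zero_iff.1 hXs
    exact tendsto_toContinuous_slope_compOp hU hg hf v
  | succ k ih =>
    intro V _ _ g U Xs hXs hU hg f hf v
    obtain rfl | ⟨Ys, X, rfl⟩ := List.eq_nil_or_concat Xs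
    · simp at hXs
    · rw [List.concat_eq_append] at hXs ⊢
      have hU' := hU.prod (isOpen_univ : IsOpen (univ : Set V))
      have hg' := contDiffOn_totalDeriv hU hg
      have hc : Continuous fun f : SmoothFun n M V => pairL (f, derivOp X f) :=
        pairL.continuous.comp (continuous_id.prodMk (continuous_derivOp X))
      have h := ih Ys (by simpa using hXs) hU' hg'
        (pairL_mem_valuesIn hf (derivOp X f)) (pairL (v, derivOp X v))
      have h' := h.comp (((hc.tendsto f).comp (tendsto_fst_nhds f v)).prodMk
        (((hc.tendsto v).comp (tendsto_fst.comp (tendsto_snd (f := 𝓝 f)))).prodMk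
          (tendsto_snd.comp (tendsto_snd (f := 𝓝 f) (g := 𝓝 v ×ˢ 𝓝[≠] (0 : ℝ))))))
      -- The limit delivered by the induction has the variation taken after the field derivative;
      -- the flip symmetry exchanges the two.
      have e : compOp (totalDeriv (totalDeriv g))
          (pairL (pairL (f, derivOp X f), pairL (v, derivOp X v))) =
          derivOp X (compOp (totalDeriv g) (pairL (f, v))) := by
        rw [derivOp_compOp hU' hg' (pairL_mem_valuesIn hf v)]
        ext x
        rw [compOp_apply (hU'.prod isOpen_univ) (contDiffOn_totalDeriv hU' hg')
            (pairL_mem_valuesIn (pairL_mem_valuesIn hf _) _),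
          compOp_apply (hU'.prod isOpen_univ) (contDiffOn_totalDeriv hU' hg')
            (pairL_mem_valuesIn (pairL_mem_valuesIn hf _) _), derivOp_pairL]
        simp only [pairL_apply]
        exact totalDeriv_totalDeriv_symm hU hg (hf x) _ _ _
      rw [e] at h'
      simp only [iterDerivOp_concat]
      refine h'.congr' ?_
      have hn := (isOpen_valuesIn (n := n) (M := M) hU).mem_nhds hf
      filter_upwards [(tendsto_fst_nhds f v).eventually hn,
        (tendsto_add_smul_nhds f v).eventually hn] with p hp1 hp2
      -- Since `f ↦ (f, X f)` is linear, moving the pair along the pair of directions is the same as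
      -- moving `f` along `v`.
      have e2 : pairL (p.1, derivOp X p.1) + p.2.2 • pairL (p.2.1, derivOp X p.2.1) =
          pairL (p.1 + p.2.2 • p.2.1, derivOp X (p.1 + p.2.2 • p.2.1)) := by
        have e3 : (p.1 + p.2.2 • p.2.1, derivOp X (p.1 + p.2.2 • p.2.1)) =
            (p.1, derivOp X p.1) + p.2.2 • (p.2.1, derivOp X p.2.1) :=
          Prod.ext rfl (by rw [map_add, map_smul]; rfl)
        rw [e3, map_add, map_smul]
      simp only [Function.comp_apply]
      rw [e2, ← derivOp_compOp hU hg hp1, ← derivOp_compOp hU hg hp2, ← map_sub, ← map_smul]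

lemma hasStrictDirDeriv_compOp (hU : IsOpen U) (hg : ContDiffOn ℝ ∞ g U)
    {f : SmoothFun n M V} (hf : f ∈ valuesIn n M U) (v : SmoothFun n M V) :
    HasStrictDirDeriv (compOp g) f v (compOp (totalDeriv g) (pairL (f, v))) :=
  tendsto_smoothFun_iff.2 fun Xs => tendsto_slope_iterDerivOp_compOp _ Xs rfl hU hg hf v

/-- The composition operator with a smooth function is smooth. -/
lemma strictCkOn_compOp (k : ℕ) :
    ∀ {V : Type} [NormedAddCommGroup V] [NormedSpace ℝ V] {g : V → W} {U : Set V}, IsOpen U →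
      ContDiffOn ℝ ∞ g U → StrictCkOn k (compOp g) (valuesIn n M U) := by
  induction k with
  | zero => intro V _ _ g U hU hg; exact continuousOn_compOp hU hg
  | succ k ih =>
    intro V _ _ g U hU hg
    -- The derivative is a composition operator after the continuous linear map `pairL`, so the
    -- induction hypothesis for `totalDeriv g` closes the loop.
    refine ⟨continuousOn_compOp hU hg, fun p => compOp (totalDeriv g) (pairL p),
      fun f hf v => hasStrictDirDeriv_compOp hU hg hf v, ?_⟩
    have h := ih (g := totalDeriv g) (hU.prod isOpen_univ) (contDiffOn_totalDeriv hU hg)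
    have h' := StrictCkOn.comp_clm k (pairL (n := n) (M := M) (V := V) (W := V)) h
    exact StrictCkOn.mono k h' fun p hp => pairL_mem_valuesIn hp.1 _

end CompositionOperators

/-! ### Projections, sections and elementary operators -/

section Operators

variable {n : ℕ} {M : Type u} [TopologicalSpace M] [ChartedSpace (EuclideanSpace ℝ (Fin n)) M]
  [IsManifold (𝓡 n) ∞ M] [CompactSpace M]

/-- The section of `C^∞(M) → C^∞(M)/ℝ` consisting of the functions which vanish at `x₀`. -/
def quotSection (x₀ : M) : (SmoothFun n M ℝ ⧸ constants n M) →L[ℝ] SmoothFun n M ℝ where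
  toLinearMap := (constants n M).liftQ
    { toFun := fun f => f - constL (f x₀)
      map_add' := fun f g => by ext x; simp; ring
      map_smul' := fun r f => by ext x; simp; ring } (by
      rintro f ⟨c, hc⟩
      refine ContMDiffMap.ext fun x => ?_
      change f x - f x₀ = 0
      rw [hc, hc, sub_self])
  cont := by
    have h : Continuous fun f : SmoothFun n M ℝ => f - constL (f x₀) :=
      continuous_id.sub (constL.continuous.comp
        (continuous_iff_continuousAt.2 fun f => tendsto_eval tendsto_id tendsto_const_nhds))
    exact h.quotient_lift _

lemma mk_quotSection (x₀ : M) (q : SmoothFun n M ℝ ⧸ constants n M) :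
    (Submodule.Quotient.mk (quotSection x₀ q) : SmoothFun n M ℝ ⧸ constants n M) = q := by
  induction q using Submodule.Quotient.induction_on with
  | H f =>
    refine (Submodule.Quotient.eq _).2 ⟨-f x₀, fun x => ?_⟩
    change f x - f x₀ - f x = _
    ring

/-- A continuous injection into a Hausdorff space suffices, and normalising at a base point provides
one. Uniqueness of derivatives with values in the quotient rests on this. -/
instance [Nonempty M] : T2Space (SmoothFun n M ℝ ⧸ constants n M) := by
  obtain ⟨x₀⟩ := ‹Nonempty M›
  exact T2Space.of_injective_continuous (f := quotSection x₀)
    (Function.LeftInverse.injective (g := Submodule.Quotient.mk) (mk_quotSection x₀))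
    (quotSection x₀).continuous

/-- Pointwise multiplication by a smooth function is continuous. -/
lemma continuous_compOp_mul : Continuous fun p : SmoothFun n M ℂ × SmoothFun n M ℂ =>
    compOp (fun z : ℂ × ℂ => z.1 * z.2) (pairL p) := by
  rw [← continuousOn_univ]
  exact (continuousOn_compOp isOpen_univ contDiff_mul.contDiffOn).comp
    pairL.continuous.continuousOn fun _ _ _ => mem_univ _

lemma compOp_mul_apply (f g : SmoothFun n M ℂ) (x : M) :
    compOp (fun z : ℂ × ℂ => z.1 * z.2) (pairL (f, g)) x = f x * g x := by
  rw [compOp_apply isOpen_univ contDiff_mul.contDiffOn (fun _ => mem_univ _), pairL_apply]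

/-- The complex conjugate of a smooth function. -/
def conjFun (f : SmoothFun n M ℂ) : SmoothFun n M ℂ := compL Complex.conjCLE.toContinuousLinearMap f

lemma continuous_cmul : Continuous fun p : ℂ × SmoothFun n M ℂ => cmul p.1 p.2 := by
  refine (continuous_compOp_mul.comp ((constL.continuous.comp continuous_fst).prodMk
    continuous_snd)).congr fun p => ?_
  ext x
  exact compOp_mul_apply _ _ x

variable [MeasurableSpace M] [BorelSpace M] (μ : Measure M) [IsFiniteMeasure μ]

/-- The linear functional `⟨φ, ·⟩`. -/
def l2L (φ : SmoothFun n M ℂ) : SmoothFun n M ℂ →L[ℝ] ℂ where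
  toFun := l2 μ φ
  map_add' := l2_add μ φ
  map_smul' r f := by
    have : r • f = cmul (r : ℂ) f := by ext x; simp
    rw [this, l2_cmul]
    simp
  cont := by
    refine ((integralL μ).continuous.comp (continuous_compOp_mul.comp
      ((continuous_const (y := conjFun φ)).prodMk continuous_id))).congr fun ψ => ?_
    exact integral_congr_ae (Eventually.of_forall fun x => compOp_mul_apply _ _ x)

@[simp] lemma l2L_apply (φ ψ : SmoothFun n M ℂ) : l2L μ φ ψ = l2 μ φ ψ := rfl

lemma add_cmul_mem_horiz (φ : Sphere n μ) (χ : SmoothFun n M ℂ) :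
    χ + cmul (-l2 μ φ.1 χ) φ.1 ∈ horiz μ φ.1 := by
  change l2 μ _ _ = 0
  rw [l2_add, l2_cmul, φ.l2_self]; ring

/-- The orthogonal projection onto the complement of a unit wave function. -/
def horizProj (φ : Sphere n μ) : SmoothFun n M ℂ →L[ℝ] horiz μ φ.1 where
  toFun χ := ⟨χ + cmul (-l2 μ φ.1 χ) φ.1, add_cmul_mem_horiz μ φ χ⟩
  map_add' f g := by
    refine Subtype.ext (ContMDiffMap.ext fun x => ?_)
    change (f x + g x) + -l2 μ φ.1 (f + g) * φ.1 x =
      (f x + -l2 μ φ.1 f * φ.1 x) + (g x + -l2 μ φ.1 g * φ.1 x)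
    rw [l2_add]; ring
  map_smul' r f := by
    refine Subtype.ext (ContMDiffMap.ext fun x => ?_)
    change r • f x + -l2L μ φ.1 (r • f) * φ.1 x = r • (f x + -l2 μ φ.1 f * φ.1 x)
    rw [map_smul, l2L_apply]
    simp; ring
  cont := Continuous.subtype_mk (continuous_id.add (continuous_cmul.comp
    ((l2L μ φ.1).continuous.neg.prodMk continuous_const))) _

lemma horizProj_coe (φ : Sphere n μ) (χ : horiz μ φ.1) : horizProj μ φ χ.1 = χ := by
  refine Subtype.ext (ContMDiffMap.ext fun x => ?_)
  change χ.1 x + -l2 μ φ.1 χ.1 * φ.1 x = χ.1 x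
  rw [show l2 μ φ.1 χ.1 = 0 from χ.2]
  simp

lemma sub_smul_mem_meanZero (ρ : Dens n μ) (f : SmoothFun n M ℝ) :
    f - (∫ x, f x ∂μ) • ρ.1 ∈ meanZero n μ := by
  change integralL μ (f - (∫ x, f x ∂μ) • ρ.1) = 0
  rw [map_sub, map_smul, integralL_apply, integralL_apply, ρ.2.2, smul_eq_mul, mul_one, sub_self]

/-- The projection onto the functions of mean zero along a density. -/
def meanZeroProj (ρ : Dens n μ) : SmoothFun n M ℝ →L[ℝ] meanZero n μ where
  toFun f := ⟨f - (∫ x, f x ∂μ) • ρ.1, sub_smul_mem_meanZero μ ρ f⟩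
  map_add' f g := by
    refine Subtype.ext (ContMDiffMap.ext fun x => ?_)
    change (f x + g x) - integralL μ (f + g) * ρ.1 x =
      (f x - integralL μ f * ρ.1 x) + (g x - integralL μ g * ρ.1 x)
    rw [map_add]; ring
  map_smul' r f := by
    refine Subtype.ext (ContMDiffMap.ext fun x => ?_)
    change r * f x - integralL μ (r • f) * ρ.1 x = r * (f x - integralL μ f * ρ.1 x)
    rw [map_smul, smul_eq_mul]; ring
  cont := Continuous.subtype_mk (continuous_id.sub
    ((integralL μ).continuous.smul continuous_const)) _

end Operators

/-! ### The coordinate expressions of the Madelung transform and of its inverse -/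

section Coordinates

/-- The function `(ρ, θ) ↦ √ρ e^{iθ/2}`. -/
def polarFun (a : ℝ × ℝ) : ℂ := (Real.sqrt a.1 : ℂ) * Complex.exp (Complex.I * (a.2 / 2 : ℝ))

/-- Twice the argument of a quotient. -/
def argFun (p : ℂ × ℂ) : ℝ := 2 * Complex.arg (p.1 / p.2)

/-- The domain where twice the argument of a quotient is smooth. -/
def argDomain : Set (ℂ × ℂ) := {p | p.2 ≠ 0 ∧ p.1 / p.2 ∈ Complex.slitPlane}

lemma isOpen_fst_pos : IsOpen {a : ℝ × ℝ | 0 < a.1} := isOpen_lt continuous_const continuous_fst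

lemma isOpen_snd_ne_zero {K : Type*} [NormedField K] : IsOpen {a : K × K | a.2 ≠ 0} :=
  isOpen_ne.preimage continuous_snd

lemma contDiffOn_polarFun : ContDiffOn ℝ ∞ polarFun {a | 0 < a.1} := by
  intro a ha
  have h1 : ContDiffAt ℝ ∞ (fun a : ℝ × ℝ => Real.sqrt a.1) a :=
    contDiffAt_fst.sqrt (ne_of_gt ha)
  have h2 : ContDiffAt ℝ ∞ (fun a : ℝ × ℝ => a.2 / 2) a := contDiffAt_snd.div_const 2
  have h3 := Complex.ofRealCLM.contDiff.contDiffAt.comp a h1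
  have h4 := Complex.ofRealCLM.contDiff.contDiffAt.comp a h2
  exact (h3.mul (contDiffAt_const.mul h4).cexp).contDiffWithinAt

lemma contDiffOn_div {K : Type*} [NormedField K] [NormedAlgebra ℝ K] :
    ContDiffOn ℝ ∞ (fun p : K × K => p.1 / p.2) {p | p.2 ≠ 0} := by
  simp_rw [div_eq_mul_inv]
  exact contDiff_fst.contDiffOn.mul (contDiff_snd.contDiffOn.inv fun _ h => h)

lemma isOpen_argDomain : IsOpen argDomain := by
  have h : ContinuousOn (fun p : ℂ × ℂ => p.1 / p.2) {p | p.2 ≠ 0} :=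
    (contDiffOn_div (K := ℂ)).continuousOn
  exact h.isOpen_inter_preimage isOpen_snd_ne_zero Complex.isOpen_slitPlane

/-- The argument is the imaginary part of the logarithm, which is smooth on the slit plane. -/
lemma contDiffOn_argFun : ContDiffOn ℝ ∞ argFun argDomain := by
  intro p hp
  have h1 : ContDiffAt ℝ ∞ (fun p : ℂ × ℂ => p.1 / p.2) p :=
    (contDiffOn_div (K := ℂ)).contDiffAt (isOpen_snd_ne_zero.mem_nhds hp.1)
  have h2 : ContDiffAt ℝ ∞ Complex.log (p.1 / p.2) :=
    (Complex.contDiffAt_log hp.2).restrict_scalars ℝ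
  have h3 := Complex.imCLM.contDiff.contDiffAt.comp p (h2.comp p h1)
  have e : argFun = fun q : ℂ × ℂ => 2 * (Complex.log (q.1 / q.2)).im := by
    funext q
    rw [argFun, Complex.log_im]
  rw [e]
  exact (contDiffAt_const.mul h3).contDiffWithinAt

variable {n : ℕ} {M : Type u} [TopologicalSpace M] [ChartedSpace (EuclideanSpace ℝ (Fin n)) M]
  [IsManifold (𝓡 n) ∞ M] [CompactSpace M]

lemma isOpen_pos : IsOpen {p : SmoothFun n M ℝ × SmoothFun n M ℝ | ∀ x, 0 < p.1 x} :=
  (isOpen_valuesIn isOpen_Ioi).preimage continuous_fst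

/-- The Madelung transform on pairs of functions. -/
def polarOp (p : SmoothFun n M ℝ × SmoothFun n M ℝ) : SmoothFun n M ℂ := compOp polarFun (pairL p)

lemma pairL_mem_pos {p : SmoothFun n M ℝ × SmoothFun n M ℝ} (hp : ∀ x, 0 < p.1 x) :
    pairL p ∈ valuesIn n M {a : ℝ × ℝ | 0 < a.1} := fun x => by
  rw [show p = (p.1, p.2) from rfl, pairL_apply]
  exact hp x

lemma polarOp_apply {p : SmoothFun n M ℝ × SmoothFun n M ℝ} (hp : ∀ x, 0 < p.1 x) (x : M) :
    polarOp p x = polarFun (p.1 x, p.2 x) := by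
  rw [polarOp, compOp_apply isOpen_fst_pos contDiffOn_polarFun (pairL_mem_pos hp),
    show p = (p.1, p.2) from rfl, pairL_apply]

lemma strictCkOn_polarOp (k : ℕ) :
    StrictCkOn k (polarOp (n := n) (M := M)) {p | ∀ x, 0 < p.1 x} :=
  StrictCkOn.mono k (StrictCkOn.comp_clm k (pairL (n := n) (M := M) (V := ℝ) (W := ℝ))
    (strictCkOn_compOp k isOpen_fst_pos contDiffOn_polarFun)) fun _ hp => pairL_mem_pos hp

/-! ### Phases near a nowhere vanishing wave function. -/

/-- The wave functions which admit a phase close to that of `ψ`. -/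
def phaseNhd (ψ : SmoothFun n M ℂ) : Set (SmoothFun n M ℂ) :=
  {χ | pairL (χ, ψ) ∈ valuesIn n M argDomain}

lemma mem_phaseNhd {ψ χ : SmoothFun n M ℂ} :
    χ ∈ phaseNhd ψ ↔ ∀ x, ψ x ≠ 0 ∧ χ x / ψ x ∈ Complex.slitPlane :=
  forall_congr' fun x => by rw [pairL_apply]; rfl

lemma isOpen_phaseNhd (ψ : SmoothFun n M ℂ) : IsOpen (phaseNhd ψ) :=
  (isOpen_valuesIn isOpen_argDomain).preimage
    (pairL.continuous.comp (continuous_id.prodMk continuous_const))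

/-- Positive factors do not change arguments. This lets the normalising factor of `affinePoint` be
dropped when phases are computed in a chart. -/
lemma cmul_mem_phaseNhd {ψ χ : SmoothFun n M ℂ} {r : ℝ} (hr : 0 < r) :
    cmul r χ ∈ phaseNhd ψ ↔ χ ∈ phaseNhd ψ := by
  simp only [mem_phaseNhd, cmul_apply, mul_div_assoc]
  refine forall_congr' fun x => and_congr_right fun _ => ?_
  rw [Complex.mem_slitPlane_iff_arg, Complex.mem_slitPlane_iff_arg, Complex.arg_real_mul _ hr]
  simp [hr.ne']

/-- The phase `θ + 2 arg (χ / ψ)`. -/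
def phaseOp (ψ : SmoothFun n M ℂ) (θ : SmoothFun n M ℝ) (χ : SmoothFun n M ℂ) :
    SmoothFun n M ℝ := compOp argFun (pairL (χ, ψ)) + θ

lemma phaseOp_apply {ψ χ : SmoothFun n M ℂ} (θ : SmoothFun n M ℝ) (h : χ ∈ phaseNhd ψ) (x : M) :
    phaseOp ψ θ χ x = 2 * Complex.arg (χ x / ψ x) + θ x := by
  change compOp argFun (pairL (χ, ψ)) x + θ x = _
  rw [compOp_apply isOpen_argDomain contDiffOn_argFun h, pairL_apply]
  rfl

lemma phaseOp_cmul {ψ χ : SmoothFun n M ℂ} (θ : SmoothFun n M ℝ) {r : ℝ} (hr : 0 < r)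
    (h : χ ∈ phaseNhd ψ) : phaseOp ψ θ (cmul r χ) = phaseOp ψ θ χ := by
  ext x
  rw [phaseOp_apply θ h, phaseOp_apply θ ((cmul_mem_phaseNhd hr).2 h), cmul_apply, mul_div_assoc,
    Complex.arg_real_mul _ hr]

lemma strictCkOn_phaseOp (k : ℕ) (ψ : SmoothFun n M ℂ) (θ : SmoothFun n M ℝ) :
    StrictCkOn k (phaseOp ψ θ) (phaseNhd ψ) := by
  have h1 : StrictCkOn k (fun χ : SmoothFun n M ℂ => pairL (χ, ψ)) (phaseNhd ψ) := by
    refine StrictCkOn.congr (ContinuousLinearMap.strictCkOn_add_const k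
      ((pairL (n := n) (M := M) (V := ℂ) (W := ℂ)).comp (.inl ℝ _ _)) (pairL (0, ψ)) _)
      (isOpen_phaseNhd ψ) fun χ _ => ?_
    change pairL (χ, 0) + pairL (0, ψ) = pairL (χ, ψ)
    rw [← map_add]; simp
  have h2 := StrictCkOn.comp k (isOpen_phaseNhd ψ)
    (strictCkOn_compOp k isOpen_argDomain contDiffOn_argFun) h1 fun χ h => h
  exact StrictCkOn.comp k (isOpen_phaseNhd ψ) (ContinuousLinearMap.strictCkOn_add_const k
    (.id ℝ (SmoothFun n M ℝ)) θ univ) h2 fun _ _ => mem_univ _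

/-! ### Squared moduli, quotients by functionals, and the chart expressions made of them. -/

/-- The pointwise squared modulus. -/
def normSqOp (ψ : SmoothFun n M ℂ) : SmoothFun n M ℝ := compOp (fun z : ℂ => ‖z‖ ^ 2) ψ

@[simp] lemma normSqOp_apply (ψ : SmoothFun n M ℂ) (x : M) : normSqOp ψ x = ‖ψ x‖ ^ 2 :=
  compOp_apply isOpen_univ (contDiff_norm_sq ℝ).contDiffOn (fun _ => mem_univ _) x

lemma strictCkOn_normSqOp (k : ℕ) : StrictCkOn k (normSqOp (n := n) (M := M)) univ :=
  StrictCkOn.mono k (strictCkOn_compOp k isOpen_univ (contDiff_norm_sq ℝ).contDiffOn)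
    fun _ _ _ => mem_univ _

lemma continuous_normSqOp : Continuous (normSqOp (n := n) (M := M)) :=
  continuousOn_univ.1 (strictCkOn_normSqOp 0).continuousOn

/-- The quotient of a function by a scalar functional. -/
def divOp {K : Type} [NormedField K] [NormedAlgebra ℝ K] (L : SmoothFun n M K →L[ℝ] K)
    (f : SmoothFun n M K) : SmoothFun n M K :=
  compOp (fun p : K × K => p.1 / p.2) (pairL (f, constL (L f)))

section DivOp
variable {K : Type} [NormedField K] [NormedAlgebra ℝ K] (L : SmoothFun n M K →L[ℝ] K)

lemma divOp_apply {f : SmoothFun n M K} (hf : L f ≠ 0) (x : M) : divOp L f x = f x / L f := by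
  rw [divOp, compOp_apply isOpen_snd_ne_zero contDiffOn_div (fun x => by
    rw [pairL_apply]; exact hf), pairL_apply]
  rfl

lemma isOpen_ne_zero : IsOpen {f | L f ≠ 0} := isOpen_ne.preimage L.continuous

lemma strictCkOn_divOp (k : ℕ) : StrictCkOn k (divOp L) {f | L f ≠ 0} := by
  have h := StrictCkOn.comp_clm k
    ((pairL (n := n) (M := M) (V := K) (W := K)).comp ((ContinuousLinearMap.id ℝ _).prod
      (constL.comp L))) (strictCkOn_compOp k isOpen_snd_ne_zero (contDiffOn_div (K := K)))
  refine StrictCkOn.mono k h fun f hf x => ?_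
  change pairL (f, constL (L f)) x ∈ _
  rw [pairL_apply]; exact hf

end DivOp

variable [MeasurableSpace M] [BorelSpace M] (μ : Measure M) [IsFiniteMeasure μ]

/-- The affine coordinate as a map on all wave functions. -/
def affineOp (φ : Sphere n μ) (ψ : SmoothFun n M ℂ) : horiz μ φ.1 :=
  horizProj μ φ (divOp (l2L μ φ.1) ψ)

lemma strictCkOn_affineOp (k : ℕ) (φ : Sphere n μ) :
    StrictCkOn k (affineOp μ φ) {ψ | l2 μ φ.1 ψ ≠ 0} :=
  StrictCkOn.comp k (isOpen_ne_zero (l2L μ φ.1))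
    (ContinuousLinearMap.strictCkOn k (horizProj μ φ) univ) (strictCkOn_divOp (l2L μ φ.1) k)
    fun _ _ => mem_univ _

/-- The function `ψ / ⟨φ, ψ⟩` has inner product 1 with `φ`, so projecting it orthogonally subtracts
exactly `φ`. -/
lemma affineCoord_eq (φ ψ : Sphere n μ) (h : l2 μ φ.1 ψ.1 ≠ 0) :
    affineCoord μ φ ψ = affineOp μ φ ψ.1 := by
  refine Subtype.ext (ContMDiffMap.ext fun x => ?_)
  have e : divOp (l2L μ φ.1) ψ.1 = cmul (l2 μ φ.1 ψ.1)⁻¹ ψ.1 := by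
    ext y
    rw [divOp_apply _ h, cmul_apply, l2L_apply, div_eq_inv_mul]
  change (l2 μ φ.1 ψ.1)⁻¹ * (ψ.1 x + -l2 μ φ.1 ψ.1 * φ.1 x) =
    divOp (l2L μ φ.1) ψ.1 x + -l2 μ φ.1 (divOp (l2L μ φ.1) ψ.1) * φ.1 x
  rw [e, l2_cmul, cmul_apply]
  field_simp

/-- The normalised squared modulus, read in the affine chart with origin `ρ`. -/
def densOp (ρ : Dens n μ) (ψ : SmoothFun n M ℂ) : meanZero n μ :=
  meanZeroProj μ ρ (divOp (integralL μ) (normSqOp ψ))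

lemma isOpen_integral_normSq : IsOpen {ψ : SmoothFun n M ℂ | ∫ x, ‖ψ x‖ ^ 2 ∂μ ≠ 0} := by
  convert (isOpen_ne_zero (integralL (n := n) (V := ℝ) μ)).preimage continuous_normSqOp using 1
  ext ψ
  simp

lemma strictCkOn_densOp (k : ℕ) (ρ : Dens n μ) :
    StrictCkOn k (densOp μ ρ) {ψ : SmoothFun n M ℂ | ∫ x, ‖ψ x‖ ^ 2 ∂μ ≠ 0} := by
  have h : StrictCkOn k (divOp (integralL μ) ∘ normSqOp)
      {ψ : SmoothFun n M ℂ | ∫ x, ‖ψ x‖ ^ 2 ∂μ ≠ 0} :=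
    StrictCkOn.comp k (isOpen_integral_normSq μ) (strictCkOn_divOp (integralL (V := ℝ) μ) k)
      ((strictCkOn_normSqOp k).mono k (subset_univ _)) fun ψ h => by simpa using h
  exact StrictCkOn.comp k (isOpen_integral_normSq μ)
    (ContinuousLinearMap.strictCkOn k (meanZeroProj μ ρ) univ) h fun _ _ => mem_univ _

/-- The density of a nowhere vanishing unit wave function. -/
def density (ψ : Sphere n μ) (h : ∀ x, ψ.1 x ≠ 0) : Dens n μ :=
  ⟨normSqOp ψ.1, fun x => by rw [normSqOp_apply]; exact pow_pos (norm_pos_iff.2 (h x)) 2, by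
    simp_rw [normSqOp_apply]; exact ψ.2⟩

lemma ne_zero_of_mem_phaseNhd {ψ χ : SmoothFun n M ℂ} (h : χ ∈ phaseNhd ψ) (x : M) : χ x ≠ 0 := by
  intro h0
  have := (mem_phaseNhd.1 h x).2
  simp [h0] at this

lemma self_mem_phaseNhd {ψ : SmoothFun n M ℂ} (h : ∀ x, ψ x ≠ 0) : ψ ∈ phaseNhd ψ :=
  mem_phaseNhd.2 fun x => ⟨h x, by rw [div_self (h x)]; exact Complex.one_mem_slitPlane⟩

lemma madelungFun_apply (ρ : Dens n μ) (θ : SmoothFun n M ℝ) (x : M) :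
    madelungFun μ ρ θ x = polarFun (ρ.1 x, θ x) := rfl

lemma madelungFun_ne_zero (ρ : Dens n μ) (θ : SmoothFun n M ℝ) (x : M) :
    madelungFun μ ρ θ x ≠ 0 := by
  intro h
  have := normSq_madelungFun μ ρ θ x
  rw [h] at this
  simp at this
  exact (ρ.2.1 x).ne this

lemma madelungFun_eq_polarOp (ρ : Dens n μ) (θ : SmoothFun n M ℝ) :
    madelungFun μ ρ θ = polarOp (ρ.1, θ) :=
  ContMDiffMap.ext fun x => (polarOp_apply (p := (ρ.1, θ)) ρ.2.1 x).symm

/-- The Madelung transform of the phase defined near a given Madelung transform. -/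
lemma madelungFun_density (ρ : Dens n μ) (θ : SmoothFun n M ℝ) (χ : Sphere n μ)
    (h : χ.1 ∈ phaseNhd (madelungFun μ ρ θ)) :
    madelungFun μ (density μ χ (ne_zero_of_mem_phaseNhd h)) (phaseOp (madelungFun μ ρ θ) θ χ.1) =
      χ.1 := by
  ext x
  have h0 := madelungFun_ne_zero μ ρ θ x
  have e : madelungFun μ ρ θ x =
    (Real.sqrt (ρ.1 x) : ℂ) * Complex.exp (Complex.I * (θ x / 2 : ℝ)) := rfl
  have hn : ‖madelungFun μ ρ θ x‖ = Real.sqrt (ρ.1 x) := by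
    rw [← normSq_madelungFun μ ρ θ x, Real.sqrt_sq (norm_nonneg _)]
  have hs : (Real.sqrt (ρ.1 x) : ℂ) ≠ 0 := by
    rw [← hn]; exact_mod_cast (norm_pos_iff.2 h0).ne'
  rw [madelungFun_apply, phaseOp_apply θ h]
  change polarFun (normSqOp χ.1 x, _) = _
  rw [normSqOp_apply, polarFun]
  simp only
  rw [Real.sqrt_sq (norm_nonneg _)]
  -- The claim is the polar decomposition of `z`, multiplied by the given value of the transform;
  -- the factor 2 in the phase cancels the halving in `polarFun`.
  set z := χ.1 x / madelungFun μ ρ θ x with hz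
  have hχ : χ.1 x = z * madelungFun μ ρ θ x := by rw [hz, div_mul_cancel₀ _ h0]
  have hexp : Complex.exp (Complex.I * ((2 * z.arg + θ x) / 2 : ℝ)) =
      Complex.exp (z.arg * Complex.I) * Complex.exp (Complex.I * (θ x / 2 : ℝ)) := by
    rw [← Complex.exp_add]
    congr 1
    push_cast
    ring
  rw [hexp, hχ, norm_mul, hn, Complex.ofReal_mul]
  rw [e]
  calc _ = (‖z‖ * Complex.exp (z.arg * Complex.I)) * ((Real.sqrt (ρ.1 x) : ℂ) *
        Complex.exp (Complex.I * (θ x / 2 : ℝ))) := by ring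
    _ = _ := by rw [Complex.norm_mul_exp_arg_mul_I]

end Coordinates

/-! ### The Madelung transform is a diffeomorphism onto an open set -/

section Diffeomorphism

variable {n : ℕ} {M : Type u} [TopologicalSpace M] [ChartedSpace (EuclideanSpace ℝ (Fin n)) M]

/-- A nonempty open set meets a chart domain in a set whose image is open and nonempty, and a
positive density has positive Lebesgue integral over it. -/
lemma IsSmoothVolume.isOpenPosMeasure [MeasurableSpace M] [BorelSpace M] {μ : Measure M}
    (hμ : IsSmoothVolume n μ) : μ.IsOpenPosMeasure := by
  refine ⟨fun U hU ⟨x, hx⟩ h0 => ?_⟩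
  set e := chartAt (EuclideanSpace ℝ (Fin n)) x
  obtain ⟨h, hc, hpos, hA⟩ := hμ e (chart_mem_atlas _ x)
  have hA := hA (U ∩ e.source) inter_subset_right (hU.inter e.open_source).measurableSet
  have ho : IsOpen (e '' (U ∩ e.source)) :=
    e.isOpen_image_of_subset_source (hU.inter e.open_source) inter_subset_right
  have hsub : e '' (U ∩ e.source) ⊆ e.target := by
    rintro _ ⟨y, hy, rfl⟩
    exact e.map_source hy.2
  have hne : (e '' (U ∩ e.source)).Nonempty := ⟨_, x, ⟨hx, mem_chart_source _ x⟩, rfl⟩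
  rw [measure_mono_null inter_subset_left h0, eq_comm, lintegral_eq_zero_iff'
    ((hc.continuousOn.mono hsub).aemeasurable ho.measurableSet).ennreal_ofReal] at hA
  have hfalse : ∀ᵐ y ∂(volume.restrict (e '' (U ∩ e.source))), False := by
    filter_upwards [hA, ae_restrict_mem ho.measurableSet] with y hy hy'
    exact (ENNReal.ofReal_pos.2 (hpos y (hsub hy'))).ne' hy
  have := ho.measure_pos volume hne
  rw [Filter.eventually_false_iff_eq_bot, ae_eq_bot, Measure.restrict_eq_zero] at hfalse
  exact this.ne' hfalse

variable [CompactSpace M] [MeasurableSpace M] [BorelSpace M] (μ : Measure M) [IsFiniteMeasure μ]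

lemma nonempty_cotDens [Nonempty M] [μ.IsOpenPosMeasure] : Nonempty (CotDens n μ) := by
  have hpos : 0 < μ.real univ :=
    ENNReal.toReal_pos (isOpen_univ.measure_pos μ univ_nonempty).ne' (measure_ne_top μ _)
  exact ⟨⟨⟨fun _ => (μ.real univ)⁻¹, contMDiff_const⟩, fun _ => inv_pos.2 hpos, by
    change ∫ _, (μ.real univ)⁻¹ ∂μ = 1
    rw [integral_const, smul_eq_mul, mul_inv_cancel₀ hpos.ne']⟩, 0⟩

variable [IsManifold (𝓡 n) ∞ M]

lemma madelung_mk (ρ : Dens n μ) (θ : SmoothFun n M ℝ) :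
    madelung μ (ρ, Submodule.Quotient.mk θ) = ProjWave.mk μ (madelungSphere μ ρ θ) := rfl

/-- A wave function in the class `Φ(p)` is the Madelung transform of a suitable phase. -/
lemma exists_phase (p : CotDens n μ) (ψ : Sphere n μ) (h : madelung μ p = ProjWave.mk μ ψ) :
    ∃ θ : SmoothFun n M ℝ, p.2 = Submodule.Quotient.mk θ ∧ madelungFun μ p.1 θ = ψ.1 := by
  obtain ⟨ρ, q⟩ := p
  induction q using Submodule.Quotient.induction_on with
  | H θ =>
    rw [madelung_mk] at h
    obtain ⟨α, hα⟩ := Quotient.exact h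
    -- A phase factor with angle `α` shifts `θ` by `2 * α`, as the transform uses half of `θ`; the
    -- class modulo constants is unchanged.
    refine ⟨θ + ⟨fun _ => 2 * α, contMDiff_const⟩, (Submodule.Quotient.eq _).2
      ⟨-(2 * α), fun x => ?_⟩, ?_⟩
    · change θ x - (θ x + 2 * α) = _
      ring
    · rw [hα]
      ext x
      change (Real.sqrt (ρ.1 x) : ℂ) * Complex.exp (Complex.I * ((θ x + 2 * α) / 2 : ℝ)) =
        Complex.exp (α * Complex.I) *
          ((Real.sqrt (ρ.1 x) : ℂ) * Complex.exp (Complex.I * (θ x / 2 : ℝ)))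
      rw [mul_left_comm, ← Complex.exp_add]
      congr 2
      push_cast
      ring

lemma range_madelung_subset : range (madelung (n := n) μ) ⊆ nonvanishing n μ := by
  rintro _ ⟨p, rfl⟩
  obtain ⟨ψ, hψ⟩ := Quotient.exists_rep (madelung μ p)
  obtain ⟨θ, -, h⟩ := exists_phase μ p ψ hψ.symm
  exact ⟨ψ, fun x => h ▸ madelungFun_ne_zero μ p.1 θ x, hψ.symm⟩

/-- The squared modulus recovers the density. Equal exponentials of half the phases make the
difference of the phases, divided by 4π, integer valued; being continuous on a connected space, it
is constant. -/
lemma madelung_injective [ConnectedSpace M] : Function.Injective (madelung (n := n) μ) := by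
  rintro p ⟨ρ', q'⟩ h
  induction q' using Submodule.Quotient.induction_on with
  | H θ' =>
    obtain ⟨θ, hθ, e⟩ := exists_phase μ p _ (h.trans (madelung_mk μ ρ' θ'))
    have e' : ∀ x, madelungFun μ p.1 θ x = madelungFun μ ρ' θ' x := fun x =>
      congrArg (fun f : SmoothFun n M ℂ => f x) e
    have hρ : p.1 = ρ' := Subtype.ext (ContMDiffMap.ext fun x => by
      rw [← normSq_madelungFun μ p.1 θ x, e', normSq_madelungFun])
    refine Prod.ext hρ (hθ.trans ((Submodule.Quotient.eq _).2 ?_))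
    have hint : ∀ x, (θ x - θ' x) / (4 * Real.pi) ∈ range ((↑) : ℤ → ℝ) := fun x => by
      have hx := e' x
      rw [hρ, madelungFun_apply, madelungFun_apply, polarFun, polarFun] at hx
      have hs : (Real.sqrt (ρ'.1 x) : ℂ) ≠ 0 := by
        exact_mod_cast (Real.sqrt_pos.2 (ρ'.2.1 x)).ne'
      obtain ⟨k, hk⟩ := Complex.exp_eq_exp_iff_exists_int.1 (mul_left_cancel₀ hs hx)
      refine ⟨k, ?_⟩
      have h2 := congrArg Complex.im hk
      simp at h2
      rw [eq_div_iff (by positivity)]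
      linarith
    have hd : IsDiscrete (range ((↑) : ℤ → ℝ)) :=
      ⟨Int.isClosedEmbedding_coe_real.isEmbedding.toHomeomorph.symm.isEmbedding.discreteTopology⟩
    have hc : Continuous fun x => (θ x - θ' x) / (4 * Real.pi) :=
      (θ.contMDiff.continuous.sub θ'.contMDiff.continuous).div_const _
    obtain ⟨c, -, hcc⟩ := isPreconnected_univ.eqOn_const_of_mapsTo hd hc.continuousOn
      (fun x _ => hint x) ⟨0, 0, by simp⟩
    refine ⟨c * (4 * Real.pi), fun x => ?_⟩
    have := hcc (mem_univ x)
    simp only [Function.const_apply] at this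
    change θ x - θ' x = _
    rw [← this]
    field_simp

lemma madelung_density (ρ : Dens n μ) (θ : SmoothFun n M ℝ) (χ : Sphere n μ)
    (h : χ.1 ∈ phaseNhd (madelungFun μ ρ θ)) :
    madelung μ (density μ χ (ne_zero_of_mem_phaseNhd h),
      Submodule.Quotient.mk (phaseOp (madelungFun μ ρ θ) θ χ.1)) = ProjWave.mk μ χ :=
  congrArg (ProjWave.mk μ) (Subtype.ext (madelungFun_density μ ρ θ χ h))

lemma isQuotientMap_mk : Topology.IsQuotientMap (ProjWave.mk (n := n) μ) := isQuotientMap_quotient_mk'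

/-- Openness is tested on the sphere: around a wave function in the image, all of its `phaseNhd` is
reached by means of the explicit phase. -/
lemma isOpen_range_madelung : IsOpen (range (madelung (n := n) μ)) := by
  rw [← (isQuotientMap_mk μ).isOpen_preimage, isOpen_iff_forall_mem_open]
  rintro ψ ⟨p, hp⟩
  obtain ⟨θ, -, h⟩ := exists_phase μ p ψ hp
  refine ⟨Subtype.val ⁻¹' phaseNhd (madelungFun μ p.1 θ), fun χ hχ =>
    ⟨_, madelung_density μ p.1 θ χ hχ⟩, (isOpen_phaseNhd _).preimage continuous_subtype_val, ?_⟩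
  change ψ.1 ∈ phaseNhd (madelungFun μ p.1 θ)
  rw [← h]
  exact self_mem_phaseNhd (madelungFun_ne_zero μ p.1 θ)

/-- A continuous choice of phase, normalised at a base point, lifts the map to the sphere. -/
lemma continuous_madelung [Nonempty M] : Continuous (madelung (n := n) μ) := by
  obtain ⟨x₀⟩ := ‹Nonempty M›
  have h : Continuous fun p : CotDens n μ => madelungSphere μ p.1 (quotSection x₀ p.2) := by
    refine Continuous.subtype_mk ?_ _
    have h1 : Continuous fun p : CotDens n μ => (p.1.1, quotSection x₀ p.2) :=
      (continuous_subtype_val.comp continuous_fst).prodMk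
        ((quotSection x₀).continuous.comp continuous_snd)
    have h2 : Continuous fun p : CotDens n μ => polarOp (p.1.1, quotSection x₀ p.2) :=
      continuousOn_univ.1 ((strictCkOn_polarOp 0).continuousOn.comp h1.continuousOn
        fun p _ => p.1.2.1)
    exact h2.congr fun p => (madelungFun_eq_polarOp μ _ _).symm
  refine ((isQuotientMap_mk μ).continuous.comp h).congr fun p => ?_
  rw [Function.comp_apply, ← madelung_mk, mk_quotSection]

/-! ### The Madelung transform and its inverse in charts. -/

lemma mk_mem_source_iff (φ ψ : Sphere n μ) :
    ProjWave.mk μ ψ ∈ (projChart μ φ).chart.source ↔ l2 μ φ.1 ψ.1 ≠ 0 := by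
  refine ⟨?_, fun h => ⟨ψ, h, rfl⟩⟩
  rintro ⟨ψ', h, e⟩
  obtain ⟨α, hα⟩ := Quotient.exact e
  rw [hα, l2_cmul] at h
  exact right_ne_zero_of_mul h

/-- Describes the inverse chart without unfolding its case distinction: the obvious point is mapped
to `a` by the chart, so `left_inv` identifies it. -/
lemma cotChart_symm (ρ₀ : Dens n μ) (a : meanZero n μ × (SmoothFun n M ℝ ⧸ constants n M))
    (h : ∀ x, 0 < (ρ₀.1 + a.1.1) x) : ∃ ρ : Dens n μ, ρ.1 = ρ₀.1 + a.1.1 ∧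
      (cotChart μ ρ₀).chart.symm a = (ρ, a.2) := by
  have hi := (integralL μ).map_add ρ₀.1 a.1.1
  rw [integralL_apply, integralL_apply, integralL_apply, ρ₀.2.2,
    show ∫ x, a.1.1 x ∂μ = 0 from a.1.2, add_zero] at hi
  refine ⟨⟨ρ₀.1 + a.1.1, h, hi⟩, rfl, ?_⟩
  have e : (cotChart μ ρ₀).chart (⟨ρ₀.1 + a.1.1, h, hi⟩, a.2) = a :=
    Prod.ext (Subtype.ext (add_sub_cancel_left ρ₀.1 a.1.1)) rfl
  exact (congrArg _ e.symm).trans ((cotChart μ ρ₀).chart.left_inv (mem_univ _))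

/-- The Madelung transform in charts. -/
lemma madelung_smooth_in_charts [Nonempty M] (ρ₀ : Dens n μ) (φ : Sphere n μ) :
    SmoothMapOn (fun a => (projChart μ φ).chart (madelung μ ((cotChart μ ρ₀).chart.symm a)))
      ((cotChart μ ρ₀).chart.target ∩ (cotChart μ ρ₀).chart.symm ⁻¹'
        (univ ∩ madelung μ ⁻¹' (projChart μ φ).chart.source)) := by
  obtain ⟨x₀⟩ := ‹Nonempty M›
  intro k
  refine StrictCkOn.ckOn k ?_
  let E := meanZero n μ × (SmoothFun n M ℝ ⧸ constants n M)
  let L : E →L[ℝ] SmoothFun n M ℝ × SmoothFun n M ℝ :=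
    ((meanZero n μ).subtypeL).prodMap (quotSection x₀)
  -- An affine lift of chart coordinates to a density and a phase vanishing at `x₀`.
  let A : E → SmoothFun n M ℝ × SmoothFun n M ℝ := fun a => L a + (ρ₀.1, 0)
  let F : E → SmoothFun n M ℂ := fun a => polarOp (A a)
  have hA : ∀ a, A a = (ρ₀.1 + a.1.1, quotSection x₀ a.2) := fun a =>
    Prod.ext (add_comm _ _) (add_zero _)
  have hAc : Continuous A := L.continuous.add continuous_const
  let s₁ : Set E := A ⁻¹' {p | ∀ x, 0 < p.1 x}
  have hs₁ : IsOpen s₁ := isOpen_pos.preimage hAc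
  have hF : StrictCkOn k F s₁ := StrictCkOn.comp k (g := polarOp) (f := A) hs₁ (strictCkOn_polarOp k)
    (ContinuousLinearMap.strictCkOn_add_const k L _ s₁) fun a ha => ha
  let s₂ : Set E := s₁ ∩ F ⁻¹' {ψ | l2 μ φ.1 ψ ≠ 0}
  have hs₂ : IsOpen s₂ :=
    hF.continuousOn.isOpen_inter_preimage hs₁ (isOpen_ne_zero (l2L μ φ.1))
  have hG : StrictCkOn k (affineOp μ φ ∘ F) s₂ := StrictCkOn.comp k hs₂ (strictCkOn_affineOp μ k φ)
    (StrictCkOn.mono k hF inter_subset_left) fun a ha => ha.2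
  have hmad : ∀ a ∈ s₁, ∃ ψ : Sphere n μ, ψ.1 = F a ∧
      madelung μ ((cotChart μ ρ₀).chart.symm a) = ProjWave.mk μ ψ := by
    intro a ha
    have h : ∀ x, 0 < (ρ₀.1 + a.1.1) x := by
      have ha' : ∀ x, 0 < (A a).1 x := ha
      rwa [hA a] at ha'
    obtain ⟨ρ, hρ, e⟩ := cotChart_symm μ ρ₀ a h
    refine ⟨madelungSphere μ ρ (quotSection x₀ a.2), ?_, ?_⟩
    · change madelungFun μ ρ _ = polarOp (A a)
      rw [madelungFun_eq_polarOp, hρ, hA a]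
    · rw [e, ← madelung_mk, mk_quotSection]
  have hset : (cotChart μ ρ₀).chart.target ∩ (cotChart μ ρ₀).chart.symm ⁻¹'
        (univ ∩ madelung μ ⁻¹' (projChart μ φ).chart.source) = s₂ := by
    ext a
    have h1 : a ∈ (cotChart μ ρ₀).chart.target ↔ a ∈ s₁ := by
      change (∀ x, 0 < (ρ₀.1 + a.1.1) x) ↔ ∀ x, 0 < (A a).1 x
      rw [hA a]
    rw [mem_inter_iff, h1]
    refine and_congr_right fun ha => ?_
    obtain ⟨ψ, hψ, e⟩ := hmad a ha
    rw [mem_preimage, univ_inter, mem_preimage, e, mk_mem_source_iff, hψ]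
    rfl
  rw [hset]
  have hfin : StrictCkOn (F := horiz μ φ.1) k (fun a : E =>
      (projChart μ φ).chart (madelung μ ((cotChart μ ρ₀).chart.symm a))) s₂ := by
    refine StrictCkOn.congr hG hs₂ fun a ha => ?_
    obtain ⟨ψ, hψ, e⟩ := hmad a ha.1
    rw [e]
    have h2 : l2 μ φ.1 ψ.1 ≠ 0 := by rw [hψ]; exact ha.2
    change affineOp μ φ (F a) = affineCoord μ φ ψ
    rw [affineCoord_eq μ φ ψ h2, hψ]
  exact hfin

/-- By injectivity, any explicit preimage is the value of the inverse; the local formula therefore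
computes the globally defined inverse. -/
lemma invFun_madelung_mk [ConnectedSpace M] [Nonempty (CotDens n μ)] (ρ : Dens n μ)
    (θ : SmoothFun n M ℝ) (χ : Sphere n μ) (h : χ.1 ∈ phaseNhd (madelungFun μ ρ θ)) :
    Function.invFun (madelung μ) (ProjWave.mk μ χ) =
      (density μ χ (ne_zero_of_mem_phaseNhd h),
        Submodule.Quotient.mk (phaseOp (madelungFun μ ρ θ) θ χ.1)) := by
  rw [← madelung_density μ ρ θ χ h]
  exact Function.leftInverse_invFun (madelung_injective μ) _

/-- Over the open image, continuity may be checked on the sphere, where the inverse is locally the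
squared modulus together with a branch of the phase. -/
lemma continuousOn_invFun_madelung [ConnectedSpace M] [Nonempty (CotDens n μ)] :
    ContinuousOn (Function.invFun (madelung (n := n) μ)) (range (madelung μ)) := by
  rw [(isQuotientMap_mk μ).continuousOn_isOpen_iff (isOpen_range_madelung μ)]
  rintro ψ ⟨p, hp⟩
  obtain ⟨θ, -, h⟩ := exists_phase μ p ψ hp
  have hψ : ψ.1 ∈ phaseNhd (madelungFun μ p.1 θ) := by
    rw [← h]
    exact self_mem_phaseNhd (madelungFun_ne_zero μ p.1 θ)
  refine ContinuousAt.continuousWithinAt ?_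
  have hn : Subtype.val ⁻¹' phaseNhd (madelungFun μ p.1 θ) ∈ 𝓝 ψ :=
    ((isOpen_phaseNhd _).preimage continuous_subtype_val).mem_nhds hψ
  have hc : ContinuousAt (fun χ : Sphere n μ => ((normSqOp χ.1,
      Submodule.Quotient.mk (phaseOp (madelungFun μ p.1 θ) θ χ.1)) :
      SmoothFun n M ℝ × (SmoothFun n M ℝ ⧸ constants n M))) ψ := by
    refine (continuous_normSqOp.comp continuous_subtype_val).continuousAt.prodMk ?_
    refine ((constants n M).mkQL.continuous.continuousAt).comp ?_
    exact (((strictCkOn_phaseOp 0 (madelungFun μ p.1 θ) θ).continuousOn.continuousAt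
      ((isOpen_phaseNhd _).mem_nhds hψ))).comp continuous_subtype_val.continuousAt
  have hi : Topology.IsInducing (Prod.map Subtype.val id :
      CotDens n μ → SmoothFun n M ℝ × (SmoothFun n M ℝ ⧸ constants n M)) :=
    Topology.IsInducing.subtypeVal.prodMap Topology.IsInducing.id
  rw [hi.continuousAt_iff]
  refine hc.congr (eventually_of_mem hn fun χ hχ => ?_)
  simp only [Function.comp_apply]
  rw [invFun_madelung_mk μ p.1 θ χ hχ]
  rfl

lemma affinePoint_eq (φ : Sphere n μ) (χ : horiz μ φ.1) :
    ∃ r : ℝ, 0 < r ∧ (affinePoint μ φ χ).1 = cmul r (φ.1 + χ.1) :=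
  ⟨_, inv_pos.2 (Real.sqrt_pos.2 (normSq_add_horiz_pos μ φ χ)), rfl⟩

/-- Dividing the squared modulus by its integral normalises it without the square root of
`affinePoint`, so the density part in charts is visibly smooth. -/
lemma densOp_add_horiz (ρ₀ : Dens n μ) (φ : Sphere n μ) (χ : horiz μ φ.1) :
    (densOp μ ρ₀ (φ.1 + χ.1)).1 = normSqOp (affinePoint μ φ χ).1 - ρ₀.1 := by
  have h0 := normSq_add_horiz_pos μ φ χ
  have h1 : integralL μ (normSqOp (φ.1 + χ.1)) = ∫ x, ‖(φ.1 + χ.1) x‖ ^ 2 ∂μ := by simp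
  have e : divOp (integralL μ) (normSqOp (φ.1 + χ.1)) = normSqOp (affinePoint μ φ χ).1 := by
    ext x
    rw [divOp_apply _ (by rw [h1]; exact h0.ne'), h1, normSqOp_apply, normSqOp_apply]
    change _ = ‖((Real.sqrt (∫ x, ‖(φ.1 + χ.1) x‖ ^ 2 ∂μ))⁻¹ : ℝ) * (φ.1 + χ.1) x‖ ^ 2
    rw [norm_mul, Complex.norm_real, mul_pow, Real.norm_eq_abs, sq_abs, inv_pow,
      Real.sq_sqrt h0.le, div_eq_inv_mul]
  change divOp (integralL μ) (normSqOp (φ.1 + χ.1)) -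
    (∫ x, divOp (integralL μ) (normSqOp (φ.1 + χ.1)) x ∂μ) • ρ₀.1 = _
  rw [e]
  have : ∫ x, normSqOp (affinePoint μ φ χ).1 x ∂μ = 1 := by
    simp_rw [normSqOp_apply]
    exact (affinePoint μ φ χ).2
  rw [this, one_smul]

/-- The inverse of the Madelung transform in charts. -/
lemma invFun_madelung_smooth_in_charts [ConnectedSpace M] [Nonempty (CotDens n μ)]
    (ρ₀ : Dens n μ) (φ : Sphere n μ) :
    SmoothMapOn (fun χ => (cotChart μ ρ₀).chart
        (Function.invFun (madelung μ) ((projChart μ φ).chart.symm χ)))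
      ((projChart μ φ).chart.target ∩ (projChart μ φ).chart.symm ⁻¹'
        (range (madelung μ) ∩ Function.invFun (madelung μ) ⁻¹' (cotChart μ ρ₀).chart.source)) := by
  intro k
  refine StrictCkOn.ckOn k ?_
  -- The branch of the phase depends on the point, so explicit formulas are available only near each
  -- `χ₀`.
  have key : ∀ χ₀ : horiz μ φ.1, ProjWave.mk μ (affinePoint μ φ χ₀) ∈ range (madelung μ) →
      ∃ t : Set (horiz μ φ.1), IsOpen t ∧ χ₀ ∈ t ∧
        (∀ χ ∈ t, ProjWave.mk μ (affinePoint μ φ χ) ∈ range (madelung μ)) ∧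
        StrictCkOn (F := meanZero n μ × (SmoothFun n M ℝ ⧸ constants n M)) k (fun χ => (cotChart μ ρ₀).chart
          (Function.invFun (madelung μ) (ProjWave.mk μ (affinePoint μ φ χ)))) t := by
    rintro χ₀ ⟨p, hp⟩
    obtain ⟨θ, -, h⟩ := exists_phase μ p _ hp
    set ψ := madelungFun μ p.1 θ with hψ
    have hnear : ∀ χ : horiz μ φ.1, (affinePoint μ φ χ).1 ∈ phaseNhd ψ ↔
        φ.1 + χ.1 ∈ phaseNhd ψ := fun χ => by
      obtain ⟨r, hr, e⟩ := affinePoint_eq μ φ χ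
      rw [e, cmul_mem_phaseNhd hr]
    have hphase : ∀ χ : horiz μ φ.1, φ.1 + χ.1 ∈ phaseNhd ψ →
        phaseOp ψ θ (affinePoint μ φ χ).1 = phaseOp ψ θ (φ.1 + χ.1) := fun χ hχ => by
      obtain ⟨r, hr, e⟩ := affinePoint_eq μ φ χ
      rw [e, phaseOp_cmul θ hr hχ]
    let A : horiz μ φ.1 → SmoothFun n M ℂ := fun χ => (horiz μ φ.1).subtypeL χ + φ.1
    have hA : ∀ χ, A χ = φ.1 + χ.1 := fun χ => add_comm _ _
    let t : Set (horiz μ φ.1) := A ⁻¹' phaseNhd ψ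
    have ht : IsOpen t := (isOpen_phaseNhd ψ).preimage
      ((horiz μ φ.1).subtypeL.continuous.add continuous_const)
    have hAs : StrictCkOn k A t := ContinuousLinearMap.strictCkOn_add_const k _ _ t
    have hmem : ∀ χ ∈ t, (affinePoint μ φ χ).1 ∈ phaseNhd ψ := fun χ hχ => by
      rw [hnear, ← hA]; exact hχ
    refine ⟨t, ht, ?_, fun χ hχ => ⟨_, madelung_density μ p.1 θ _ (hmem χ hχ)⟩, ?_⟩
    · change A χ₀ ∈ phaseNhd ψ
      rw [hA, ← hnear, ← h]
      exact self_mem_phaseNhd (madelungFun_ne_zero μ p.1 θ)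
    · have h1 : StrictCkOn k (densOp μ ρ₀ ∘ A) t :=
        StrictCkOn.comp k ht (strictCkOn_densOp μ k ρ₀) hAs fun χ _ => by
          rw [hA]
          exact (normSq_add_horiz_pos μ φ χ).ne'
      have h2 : StrictCkOn k (phaseOp ψ θ ∘ A) t :=
        StrictCkOn.comp k ht (strictCkOn_phaseOp k ψ θ) hAs fun χ hχ => hχ
      have h3 : StrictCkOn k ((constants n M).mkQL ∘ (phaseOp ψ θ ∘ A)) t :=
        StrictCkOn.comp k ht (ContinuousLinearMap.strictCkOn k (constants n M).mkQL univ) h2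
          fun _ _ => mem_univ _
      refine StrictCkOn.congr (StrictCkOn.prodMk k h1 h3) ht fun χ hχ => ?_
      rw [invFun_madelung_mk μ p.1 θ _ (hmem χ hχ)]
      refine Prod.ext (Subtype.ext ?_) ?_
      · change (densOp μ ρ₀ (A χ)).1 = normSqOp (affinePoint μ φ χ).1 - ρ₀.1
        rw [hA, densOp_add_horiz]
      · change (Submodule.Quotient.mk (phaseOp ψ θ (A χ)) : SmoothFun n M ℝ ⧸ constants n M) =
          Submodule.Quotient.mk (phaseOp ψ θ (affinePoint μ φ χ).1)
        rw [hA, hphase χ (by rw [← hA]; exact hχ)]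
  have : Nonempty M := inferInstance
  have hset : (projChart μ φ).chart.target ∩ (projChart μ φ).chart.symm ⁻¹'
      (range (madelung μ) ∩ Function.invFun (madelung μ) ⁻¹' (cotChart μ ρ₀).chart.source) =
      {χ : horiz μ φ.1 | ProjWave.mk μ (affinePoint μ φ χ) ∈ range (madelung μ)} :=
    Set.ext fun χ => ⟨fun h => h.2.1, fun h => ⟨mem_univ _, h, mem_univ _⟩⟩
  rw [hset]
  have hfin : StrictCkOn (F := meanZero n μ × (SmoothFun n M ℝ ⧸ constants n M)) k
      (fun χ : horiz μ φ.1 => (cotChart μ ρ₀).chart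
        (Function.invFun (madelung μ) (ProjWave.mk μ (affinePoint μ φ χ))))
      {χ | ProjWave.mk μ (affinePoint μ φ χ) ∈ range (madelung μ)} := by
    -- Different branches give the same map, namely the inverse. Local smoothness thus suffices, and
    -- the same neighbourhoods show that the domain is open.
    refine StrictCkOn.of_locally k (isOpen_iff_forall_mem_open.2 fun χ₀ h => ?_) fun χ₀ h => ?_
    · obtain ⟨t, ht, hχ, hr, -⟩ := key χ₀ h
      exact ⟨t, hr, ht, hχ⟩
    · obtain ⟨t, ht, hχ, -, hs⟩ := key χ₀ h
      exact ⟨t, ht, hχ, hs⟩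
  exact hfin

end Diffeomorphism

/-! ### The image for simply connected manifolds -/

section SimplyConnected

variable {n : ℕ} {M : Type u} [TopologicalSpace M] [ChartedSpace (EuclideanSpace ℝ (Fin n)) M]

/-- A continuous logarithm of a smooth function is smooth. -/
lemma contMDiff_im_of_exp_eq {ψ : SmoothFun n M ℂ} {L : M → ℂ} (hL : Continuous L)
    (h : ∀ x, Complex.exp (L x) = ψ x) :
    ContMDiff (𝓡 n) 𝓘(ℝ, ℝ) ∞ fun x => 2 * (L x).im := by
  intro x₀
  have hne : ∀ x, ψ x ≠ 0 := fun x => by rw [← h]; exact Complex.exp_ne_zero _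
  -- A local smooth formula for twice the imaginary part of `L`, from the principal branch of the
  -- logarithm at 1.
  have h1 : ContDiffAt ℝ ∞ (fun z : ℂ => 2 * ((L x₀).im + (Complex.log (z / ψ x₀)).im)) (ψ x₀) := by
    have h2 : ContDiffAt ℝ ∞ (fun z : ℂ => z / ψ x₀) (ψ x₀) := contDiffAt_id.div_const _
    have h3 : ContDiffAt ℝ ∞ Complex.log (ψ x₀ / ψ x₀) := by
      rw [div_self (hne x₀)]
      exact (Complex.contDiffAt_log Complex.one_mem_slitPlane).restrict_scalars ℝ
    have h4 := Complex.imCLM.contDiff.contDiffAt.comp _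
      (ContDiffAt.comp (ψ x₀) (g := Complex.log) (f := fun z : ℂ => z / ψ x₀) h3 h2)
    exact contDiffAt_const.mul (contDiffAt_const.add h4)
  refine (h1.contMDiffAt.comp x₀ (ψ.contMDiff x₀)).congr_of_eventuallyEq ?_
  -- By continuity `L - L x₀` has imaginary part between -π and π near `x₀`, where the principal
  -- logarithm inverts the exponential.
  have hc : Tendsto (fun x => (L x - L x₀).im) (𝓝 x₀) (𝓝 0) := by
    have : Continuous fun x => (L x - L x₀).im := by fun_prop
    simpa using this.tendsto x₀
  filter_upwards [hc.eventually (Ioo_mem_nhds (neg_lt_zero.2 Real.pi_pos) Real.pi_pos)] with x hx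
  have e : ψ x / ψ x₀ = Complex.exp (L x - L x₀) := by rw [Complex.exp_sub, h, h]
  simp only [Function.comp_apply]
  rw [e, Complex.log_exp hx.1 hx.2.le, Complex.sub_im]
  ring

variable [IsManifold (𝓡 n) ∞ M] [CompactSpace M] [MeasurableSpace M] [BorelSpace M]
  (μ : Measure M) [IsFiniteMeasure μ]

/-- A nowhere vanishing function on a simply connected, locally path connected space has a
continuous logarithm, and twice its imaginary part is the required phase. -/
lemma range_madelung_eq [SimplyConnectedSpace M] :
    range (madelung (n := n) μ) = nonvanishing n μ := by
  refine (range_madelung_subset μ).antisymm ?_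
  rintro _ ⟨ψ, hψ, rfl⟩
  have : LocallyPathConnectedSpace M :=
    ChartedSpace.locallyPathConnectedSpace (EuclideanSpace ℝ (Fin n)) M
  have hs : IsSimplyConnected (univ : Set M) :=
    (Homeomorph.Set.univ M).toHomotopyEquiv.simplyConnectedSpace_iff.2 inferInstance
  obtain ⟨L, hL, he⟩ := Complex.exists_continuousOn_eqOn_exp_comp hs isOpen_univ
    ψ.1.contMDiff.continuous.continuousOn (by rintro ⟨x, -, hx⟩; exact hψ x hx)
  have he' : ∀ x, Complex.exp (L x) = ψ.1 x := fun x => he (mem_univ x)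
  have hsm := contMDiff_im_of_exp_eq (continuousOn_univ.1 hL) he'
  refine ⟨(density μ ψ hψ, Submodule.Quotient.mk ⟨_, hsm⟩), ?_⟩
  refine congrArg (ProjWave.mk μ) (Subtype.ext (ContMDiffMap.ext fun x => ?_))
  change (Real.sqrt (normSqOp ψ.1 x) : ℂ) *
    Complex.exp (Complex.I * (2 * (L x).im / 2 : ℝ)) = ψ.1 x
  rw [normSqOp_apply, Real.sqrt_sq (norm_nonneg _), ← he', Complex.norm_exp, Complex.ofReal_exp,
    ← Complex.exp_add]
  congr 1
  rw [mul_div_cancel_left₀ _ (two_ne_zero), mul_comm]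
  exact Complex.re_add_im _

end SimplyConnected

/-! ### The Kähler structures -/

section Kahler

variable {n : ℕ} {M : Type u} [TopologicalSpace M] [ChartedSpace (EuclideanSpace ℝ (Fin n)) M]
  [CompactSpace M] [MeasurableSpace M] [BorelSpace M] (μ : Measure M) [IsFiniteMeasure μ]

lemma cotTangent_ext {p : CotDens n μ} {v w : cotTangent μ p}
    (h1 : ∀ x, v.1.1 x = w.1.1 x) (h2 : ∀ x, v.1.2 x = w.1.2 x) : v = w :=
  Subtype.ext (Prod.ext (ContMDiffMap.ext h1) (ContMDiffMap.ext h2))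

lemma cotJ_cotJ {p : CotDens n μ} (v : cotTangent μ p) : cotJ μ (cotJ μ v) = -v := by
  refine cotTangent_ext μ (fun x => ?_) fun x => ?_
  · change -(v.1.1 x / p.1.1 x * p.1.1 x) = -v.1.1 x
    rw [div_mul_cancel₀ _ (p.1.2.1 x).ne']
  · change -(v.1.2 x * p.1.1 x) / p.1.1 x = -v.1.2 x
    rw [neg_div, mul_div_cancel_right₀ _ (p.1.2.1 x).ne']

/-- The integrand is continuous, nonnegative and not identically zero, and `μ` charges open sets. -/
lemma sasakiFisherRao_pos [μ.IsOpenPosMeasure] {p : CotDens n μ} (v : cotTangent μ p)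
    (hv : v ≠ 0) : 0 < sasakiFisherRao μ v v := by
  have hρ := p.1.2.1
  obtain ⟨x, hx⟩ : ∃ x, v.1.1 x ≠ 0 ∨ v.1.2 x ≠ 0 := by
    by_contra! h
    exact hv (cotTangent_ext μ (fun x => (h x).1) fun x => (h x).2)
  have hc : Continuous fun x => ((v.1.1 x / p.1.1 x) * (v.1.1 x / p.1.1 x) +
      v.1.2 x * v.1.2 x) * p.1.1 x := by
    have h1 := v.1.1.contMDiff.continuous
    have h2 := v.1.2.contMDiff.continuous
    have h3 := p.1.1.contMDiff.continuous
    have h4 := h1.div h3 fun x => (hρ x).ne'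
    exact ((h4.mul h4).add (h2.mul h2)).mul h3
  refine mul_pos (by norm_num) (hc.integral_pos_of_hasCompactSupport_nonneg_nonzero
    (HasCompactSupport.of_compactSpace _) (x := x) (fun y => ?_) ?_)
  · exact mul_nonneg (add_nonneg (mul_self_nonneg _) (mul_self_nonneg _)) (hρ y).le
  · refine mul_ne_zero (ne_of_gt ?_) (hρ x).ne'
    rcases hx with hx | hx
    · exact add_pos_of_pos_of_nonneg (mul_self_pos.2 (div_ne_zero hx (hρ x).ne'))
        (mul_self_nonneg _)
    · exact add_pos_of_nonneg_of_pos (mul_self_nonneg _) (mul_self_pos.2 hx)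

lemma sasakiFisherRao_cotJ {p : CotDens n μ} (v w : cotTangent μ p) :
    sasakiFisherRao μ (cotJ μ v) w = 1 / 4 * canonicalForm μ v w := by
  refine congrArg (1 / 4 * ·) (integral_congr_ae (Eventually.of_forall fun x => ?_))
  change (-(v.1.2 x * p.1.1 x) / p.1.1 x * (w.1.1 x / p.1.1 x) +
    v.1.1 x / p.1.1 x * w.1.2 x) * p.1.1 x = v.1.1 x * w.1.2 x - w.1.1 x * v.1.2 x
  have := (p.1.2.1 x).ne'
  field_simp
  ring

/-! ### Hermitian computations with the logarithmic derivative. -/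

/-- The factor `ρ'/(2ρ) + i θ'/2` of the differential of the Madelung transform. -/
def logDeriv (ρ r t : ℝ) : ℂ := ((r / (2 * ρ) : ℝ) : ℂ) + ((t / 2 : ℝ) : ℂ) * Complex.I

lemma logDeriv_re (ρ r t : ℝ) : (logDeriv ρ r t).re = r / (2 * ρ) := by
  rw [logDeriv, Complex.add_re, Complex.ofReal_re, Complex.re_ofReal_mul, Complex.I_re, mul_zero,
    add_zero]

lemma logDeriv_im (ρ r t : ℝ) : (logDeriv ρ r t).im = t / 2 := by
  rw [logDeriv, Complex.add_im, Complex.ofReal_im, Complex.im_ofReal_mul, Complex.I_im, mul_one,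
    zero_add]

/-- The real and imaginary parts are half of the integrands that `cotTangent` requires to have
integral zero, whence horizontality. -/
lemma conj_mul_mul_logDeriv {ρ : ℝ} (hρ : ρ ≠ 0) {z : ℂ} (hz : ‖z‖ ^ 2 = ρ) (r t : ℝ) :
    conj z * (z * logDeriv ρ r t) = ((r / 2 : ℝ) : ℂ) + ((t * ρ / 2 : ℝ) : ℂ) * Complex.I := by
  rw [← mul_assoc, Complex.conj_mul', ← Complex.ofReal_pow, hz, logDeriv]
  have : (ρ : ℂ) ≠ 0 := by exact_mod_cast hρ
  push_cast
  field_simp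

/-- The pointwise heart of the isometry: the metric and the symplectic form appear together as the
two parts of one Hermitian product. -/
lemma conj_mul_logDeriv_mul {ρ : ℝ} (hρ : ρ ≠ 0) {z : ℂ} (hz : ‖z‖ ^ 2 = ρ) (r t r' t' : ℝ) :
    conj (z * logDeriv ρ r t) * (z * logDeriv ρ r' t') =
      ((1 / 4 * ((r / ρ * (r' / ρ) + t * t') * ρ) : ℝ) : ℂ) +
        ((1 / 4 * (r * t' - r' * t) : ℝ) : ℂ) * Complex.I := by
  have e : conj (z * logDeriv ρ r t) * (z * logDeriv ρ r' t') =
      (conj z * z) * (conj (logDeriv ρ r t) * logDeriv ρ r' t') := by rw [map_mul]; ring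
  rw [e, Complex.conj_mul', ← Complex.ofReal_pow, hz, logDeriv, logDeriv]
  simp only [map_add, map_mul, Complex.conj_ofReal, Complex.conj_I]
  have : (ρ : ℂ) ≠ 0 := by exact_mod_cast hρ
  push_cast
  field_simp
  ring_nf
  rw [Complex.I_sq]
  ring

lemma l2_re (φ ψ : SmoothFun n M ℂ) : (l2 μ φ ψ).re = ∫ x, (conj (φ x) * ψ x).re ∂μ :=
  (Complex.reCLM.integral_comp_comm (integrable_of_continuous μ (continuous_l2_aux φ ψ))).symm

lemma l2_im (φ ψ : SmoothFun n M ℂ) : (l2 μ φ ψ).im = ∫ x, (conj (φ x) * ψ x).im ∂μ :=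
  (Complex.imCLM.integral_comp_comm (integrable_of_continuous μ (continuous_l2_aux φ ψ))).symm

/-- The function `ψ (ρ'/(2ρ) + i θ'/2)`. -/
def waveDeriv (p : CotDens n μ) (ψ : SmoothFun n M ℂ) (v : SmoothFun n M ℝ × SmoothFun n M ℝ) :
    SmoothFun n M ℂ :=
  ⟨fun x => ψ x * logDeriv (p.1.1 x) (v.1 x) (v.2 x), by
    have h1 : ContMDiff (𝓡 n) 𝓘(ℝ, ℝ) ∞ fun x => v.1 x / p.1.1 x :=
      v.1.contMDiff.div₀ p.1.1.contMDiff fun x => (p.1.2.1 x).ne'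
    have h2 : ContDiff ℝ ∞ fun q : ℂ × ℝ × ℝ =>
        q.1 * (((q.2.1 / 2 : ℝ) : ℂ) + ((q.2.2 / 2 : ℝ) : ℂ) * Complex.I) := by
      have h3 : ContDiff ℝ ∞ fun q : ℂ × ℝ × ℝ => ((q.2.1 / 2 : ℝ) : ℂ) :=
        Complex.ofRealCLM.contDiff.comp ((contDiff_fst.comp contDiff_snd).div_const 2)
      have h4 : ContDiff ℝ ∞ fun q : ℂ × ℝ × ℝ => ((q.2.2 / 2 : ℝ) : ℂ) :=
        Complex.ofRealCLM.contDiff.comp ((contDiff_snd.comp contDiff_snd).div_const 2)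
      exact contDiff_fst.mul (h3.add (h4.mul contDiff_const))
    refine (h2.contMDiff.comp (ψ.contMDiff.prodMk_space
      (h1.prodMk_space v.2.contMDiff))).congr fun x => ?_
    simp only [Function.comp_apply, logDeriv]
    rw [div_div, mul_comm (p.1.1 x)]⟩

lemma waveDeriv_apply (p : CotDens n μ) (ψ : SmoothFun n M ℂ)
    (v : SmoothFun n M ℝ × SmoothFun n M ℝ) (x : M) :
    waveDeriv μ p ψ v x = ψ x * logDeriv (p.1.1 x) (v.1 x) (v.2 x) := rfl

lemma l2_waveDeriv {p : CotDens n μ} {ψ : SmoothFun n M ℂ} (hψ : ∀ x, ‖ψ x‖ ^ 2 = p.1.1 x)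
    (v : cotTangent μ p) : l2 μ ψ (waveDeriv μ p ψ v.1) = 0 := by
  have e : ∀ x, conj (ψ x) * waveDeriv μ p ψ v.1 x = _ := fun x =>
    conj_mul_mul_logDeriv (p.1.2.1 x).ne' (hψ x) (v.1.1 x) (v.1.2 x)
  refine Complex.ext ?_ ?_
  · rw [l2_re]
    simp_rw [e]
    have := v.2.1
    simp [integral_div, this]
  · rw [l2_im]
    simp_rw [e]
    have := v.2.2
    simp [integral_div, this]

lemma l2_waveDeriv_waveDeriv_re {p : CotDens n μ} {ψ : SmoothFun n M ℂ}
    (hψ : ∀ x, ‖ψ x‖ ^ 2 = p.1.1 x) (v w : cotTangent μ p) :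
    (l2 μ (waveDeriv μ p ψ v.1) (waveDeriv μ p ψ w.1)).re = sasakiFisherRao μ v w := by
  rw [l2_re, sasakiFisherRao, ← integral_const_mul]
  refine integral_congr_ae (Eventually.of_forall fun x => ?_)
  simp only [waveDeriv_apply]
  rw [conj_mul_logDeriv_mul (p.1.2.1 x).ne' (hψ x)]
  simp only [Complex.add_re, Complex.ofReal_re, Complex.re_ofReal_mul, Complex.I_re, mul_zero,
    add_zero]

lemma l2_waveDeriv_waveDeriv_im {p : CotDens n μ} {ψ : SmoothFun n M ℂ}
    (hψ : ∀ x, ‖ψ x‖ ^ 2 = p.1.1 x) (v w : cotTangent μ p) :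
    4 * (l2 μ (waveDeriv μ p ψ v.1) (waveDeriv μ p ψ w.1)).im = canonicalForm μ v w := by
  rw [l2_im, canonicalForm, ← integral_const_mul]
  refine integral_congr_ae (Eventually.of_forall fun x => ?_)
  simp only [waveDeriv_apply]
  rw [conj_mul_logDeriv_mul (p.1.2.1 x).ne' (hψ x)]
  simp only [Complex.add_im, Complex.ofReal_im, Complex.im_ofReal_mul, Complex.I_im, mul_one,
    zero_add]
  ring

/-- Horizontality kills the correction term, and `ψ` has norm one. -/
lemma hermitianFubiniStudy_waveDeriv {p : CotDens n μ} (ψ : Sphere n μ)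
    (hψ : ∀ x, ‖ψ.1 x‖ ^ 2 = p.1.1 x) (v w : cotTangent μ p) :
    hermitianFubiniStudy μ ψ.1 (waveDeriv μ p ψ.1 v.1) (waveDeriv μ p ψ.1 w.1) =
      l2 μ (waveDeriv μ p ψ.1 v.1) (waveDeriv μ p ψ.1 w.1) := by
  rw [hermitianFubiniStudy, ψ.l2_self, l2_waveDeriv μ hψ w]
  simp

/-- The logarithmic derivative of `(-ρ θ', ρ'/ρ)` is `-θ'/2 + i ρ'/(2ρ)`, which is `i` times that of
`(ρ', θ')`. -/
lemma waveDeriv_cotJ {p : CotDens n μ} (ψ : SmoothFun n M ℂ) (v : cotTangent μ p) :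
    waveDeriv μ p ψ (cotJ μ v).1 = cmul Complex.I (waveDeriv μ p ψ v.1) := by
  ext x
  have h : (p.1.1 x : ℂ) ≠ 0 := by exact_mod_cast (p.1.2.1 x).ne'
  change ψ x * logDeriv (p.1.1 x) (-(v.1.2 x * p.1.1 x)) (v.1.1 x / p.1.1 x) =
    Complex.I * (ψ x * logDeriv (p.1.1 x) (v.1.1 x) (v.1.2 x))
  rw [mul_left_comm]
  congr 1
  rw [logDeriv, logDeriv]
  push_cast
  field_simp
  ring_nf
  rw [Complex.I_sq]
  ring

variable [IsManifold (𝓡 n) ∞ M]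

/-- The differential of the Madelung transform, as a linear isomorphism of tangent spaces. -/
lemma exists_waveDeriv_equiv (p : CotDens n μ) (ψ : Sphere n μ)
    (hψ : ∀ x, ‖ψ.1 x‖ ^ 2 = p.1.1 x) :
    ∃ D : cotTangent μ p ≃ₗ[ℝ] horiz μ ψ.1, ∀ v, (D v).1 = waveDeriv μ p ψ.1 v.1 := by
  have hρ := p.1.2.1
  have hne : ∀ x, ψ.1 x ≠ 0 := fun x h0 => by
    have := hψ x
    rw [h0, norm_zero, zero_pow two_ne_zero] at this
    exact (hρ x).ne this
  let D : cotTangent μ p →ₗ[ℝ] horiz μ ψ.1 :=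
    { toFun := fun v => ⟨waveDeriv μ p ψ.1 v.1, l2_waveDeriv μ hψ v⟩
      map_add' := fun v w => by
        refine Subtype.ext (ContMDiffMap.ext fun x => ?_)
        change ψ.1 x * logDeriv (p.1.1 x) (v.1.1 x + w.1.1 x) (v.1.2 x + w.1.2 x) =
          ψ.1 x * logDeriv (p.1.1 x) (v.1.1 x) (v.1.2 x) +
            ψ.1 x * logDeriv (p.1.1 x) (w.1.1 x) (w.1.2 x)
        simp only [logDeriv]
        push_cast
        ring
      map_smul' := fun r v => by
        refine Subtype.ext (ContMDiffMap.ext fun x => ?_)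
        change ψ.1 x * logDeriv (p.1.1 x) (r * v.1.1 x) (r * v.1.2 x) =
          r • (ψ.1 x * logDeriv (p.1.1 x) (v.1.1 x) (v.1.2 x))
        simp only [logDeriv, Complex.real_smul]
        push_cast
        ring }
  have hval : ∀ (v : cotTangent μ p) x,
      (D v).1 x / ψ.1 x = logDeriv (p.1.1 x) (v.1.1 x) (v.1.2 x) := fun v x => by
    change ψ.1 x * logDeriv (p.1.1 x) (v.1.1 x) (v.1.2 x) / ψ.1 x = _
    rw [mul_div_cancel_left₀ _ (hne x)]
  refine ⟨LinearEquiv.ofBijective D ⟨fun v w h => ?_, fun χ => ?_⟩, fun v => rfl⟩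
  · have e : ∀ x, logDeriv (p.1.1 x) (v.1.1 x) (v.1.2 x) =
        logDeriv (p.1.1 x) (w.1.1 x) (w.1.2 x) := fun x => by rw [← hval, ← hval, h]
    refine cotTangent_ext μ (fun x => ?_) fun x => ?_
    · have := congrArg Complex.re (e x)
      rw [logDeriv_re, logDeriv_re] at this
      exact (div_left_inj' (mul_pos two_pos (hρ x)).ne').1 this
    · have := congrArg Complex.im (e x)
      rw [logDeriv_im, logDeriv_im] at this
      exact (div_left_inj' two_ne_zero).1 this
  -- Surjectivity: the preimage must have logarithmic derivative `q = χ/ψ`, which forces `r = 2 ρ Re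
  -- q` and `t = 2 Im q`.
  · let q : SmoothFun n M ℂ := compOp (fun z : ℂ × ℂ => z.1 / z.2) (pairL (χ.1, ψ.1))
    have hq : ∀ x, q x = χ.1 x / ψ.1 x := fun x => by
      change compOp _ _ x = _
      rw [compOp_apply isOpen_snd_ne_zero contDiffOn_div (fun x => by
        rw [pairL_apply]; exact hne x), pairL_apply]
    let r : SmoothFun n M ℝ := (2 : ℝ) • (p.1.1 * compL Complex.reCLM q)
    let t : SmoothFun n M ℝ := (2 : ℝ) • compL Complex.imCLM q
    have hr : ∀ x, r x = 2 * (p.1.1 x * (q x).re) := fun x => rfl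
    have ht : ∀ x, t x = 2 * (q x).im := fun x => rfl
    have hχ : l2 μ ψ.1 χ.1 = 0 := χ.2
    -- Integrated, this turns the horizontality of `χ` into the two normalisations of `(r, t)`.
    have hc : ∀ x, conj (ψ.1 x) * χ.1 x = p.1.1 x * q x := fun x => by
      have : χ.1 x = ψ.1 x * q x := by rw [hq, mul_div_cancel₀ _ (hne x)]
      rw [this, ← mul_assoc, Complex.conj_mul', ← hψ, Complex.ofReal_pow]
    have h1 := congrArg Complex.re hχ
    have h2 := congrArg Complex.im hχ
    rw [l2_re] at h1
    rw [l2_im] at h2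
    simp_rw [hc, Complex.re_ofReal_mul] at h1
    simp_rw [hc, Complex.im_ofReal_mul] at h2
    refine ⟨⟨(r, t), ?_, ?_⟩, Subtype.ext (ContMDiffMap.ext fun x => ?_)⟩
    · simp_rw [hr, integral_const_mul, h1]
      simp
    · have : ∀ x, t x * p.1.1 x = 2 * (p.1.1 x * (q x).im) := fun x => by rw [ht]; ring
      simp_rw [this, integral_const_mul, h2]
      simp
    · change ψ.1 x * logDeriv (p.1.1 x) (r x) (t x) = χ.1 x
      have hl : logDeriv (p.1.1 x) (r x) (t x) = q x := by
        have h0 := (hρ x).ne'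
        rw [logDeriv, hr, ht, show 2 * (p.1.1 x * (q x).re) / (2 * p.1.1 x) = (q x).re by
          field_simp, mul_div_cancel_left₀ _ (two_ne_zero), Complex.re_add_im]
      rw [hl, hq, mul_div_cancel₀ _ (hne x)]

end Kahler

/-! ### The differential of the Madelung transform -/

section Differential

lemma totalDeriv_eq_of_hasDerivAt {V W : Type} [NormedAddCommGroup V] [NormedSpace ℝ V]
    [NormedAddCommGroup W] [NormedSpace ℝ W] {g : V → W} {x v : V} {w : W}
    (hg : DifferentiableAt ℝ g x) (h : HasDerivAt (fun t : ℝ => g (x + t • v)) w 0) :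
    totalDeriv g (x, v) = w :=
  (hg.lineDeriv_eq_fderiv).symm.trans h.deriv

lemma totalDeriv_polarFun {a b : ℝ × ℝ} (ha : 0 < a.1) :
    totalDeriv polarFun (a, b) = polarFun a * logDeriv a.1 b.1 b.2 := by
  refine totalDeriv_eq_of_hasDerivAt ((contDiffOn_polarFun.contDiffAt
    (isOpen_fst_pos.mem_nhds ha)).differentiableAt (by simp)) ?_
  have h1 : HasDerivAt (fun t : ℝ => a.1 + t * b.1) b.1 0 := by
    simpa using ((hasDerivAt_id (0 : ℝ)).mul_const b.1).const_add a.1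
  have h2 : HasDerivAt (fun t : ℝ => (a.2 + t * b.2) / 2) (b.2 / 2) 0 := by
    simpa using (((hasDerivAt_id (0 : ℝ)).mul_const b.2).const_add a.2).div_const 2
  have h3 := (h1.sqrt (by simpa using ha.ne')).ofReal_comp
  have h4 := (h2.ofReal_comp.const_mul Complex.I).cexp
  have h5 := h3.mul h4
  refine HasDerivAt.congr_deriv h5 ?_
  have hs : (Real.sqrt a.1 : ℂ) ≠ 0 := by exact_mod_cast (Real.sqrt_pos.2 ha).ne'
  -- Writing the density as the square of its root reconciles the derivative of the root with the
  -- factor `b.1 / (2 * a.1)` of `logDeriv`.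
  have hs2 : (a.1 : ℂ) = (Real.sqrt a.1 : ℂ) ^ 2 := by
    rw [← Complex.ofReal_pow, Real.sq_sqrt ha.le]
  simp only [zero_mul, add_zero, polarFun, logDeriv]
  push_cast
  rw [hs2]
  field_simp

lemma totalDeriv_div {a c : ℂ} : totalDeriv (fun p : ℂ × ℂ => p.1 / p.2) ((a, 1), (c, 0)) = c := by
  refine totalDeriv_eq_of_hasDerivAt (((contDiffOn_div (K := ℂ)).contDiffAt
    (isOpen_snd_ne_zero.mem_nhds (one_ne_zero : (1 : ℂ) ≠ 0))).differentiableAt (by simp)) ?_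
  have h : HasDerivAt (fun t : ℝ => a + (t : ℂ) * c) c 0 := by
    simpa using (((hasDerivAt_id (0 : ℝ)).ofReal_comp).mul_const c).const_add a
  refine h.congr_of_eventuallyEq (Eventually.of_forall fun t => ?_)
  simp

variable {n : ℕ} {M : Type u} [TopologicalSpace M] [ChartedSpace (EuclideanSpace ℝ (Fin n)) M]
  [IsManifold (𝓡 n) ∞ M] [CompactSpace M] [MeasurableSpace M] [BorelSpace M]
  (μ : Measure M) [IsFiniteMeasure μ]

lemma hasStrictDirDeriv_polarOp (p : CotDens n μ) (θ : SmoothFun n M ℝ)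
    (v : SmoothFun n M ℝ × SmoothFun n M ℝ) :
    HasStrictDirDeriv polarOp (p.1.1, θ) v (waveDeriv μ p (madelungFun μ p.1 θ) v) := by
  have hp : pairL (p.1.1, θ) ∈ valuesIn n M {a : ℝ × ℝ | 0 < a.1} :=
    pairL_mem_pos (p := (p.1.1, θ)) p.1.2.1
  let P : SmoothFun n M ℝ × SmoothFun n M ℝ →L[ℝ] SmoothFun n M (ℝ × ℝ) := pairL
  have h := (hasStrictDirDeriv_compOp isOpen_fst_pos contDiffOn_polarFun hp (P v)).comp (f := P)
    (ContinuousLinearMap.hasStrictDirDeriv P (p.1.1, θ) v) P.continuous.continuousAt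
  have e : compOp (totalDeriv polarFun) (pairL (P (p.1.1, θ), P v)) =
      waveDeriv μ p (madelungFun μ p.1 θ) v := by
    ext x
    rw [compOp_apply (isOpen_fst_pos.prod isOpen_univ)
      (contDiffOn_totalDeriv isOpen_fst_pos contDiffOn_polarFun) (pairL_mem_valuesIn hp _),
      pairL_apply]
    have e1 : P (p.1.1, θ) x = (p.1.1 x, θ x) := pairL_apply _ _ _
    have e2 : P v x = (v.1 x, v.2 x) := pairL_apply v.1 v.2 x
    rw [e1, e2, totalDeriv_polarFun (p.1.2.1 x)]
    rfl
  rw [e] at h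
  exact h

/-- At the centre of the chart the denominator is `⟨ψ, ψ⟩ = 1`, and along a horizontal vector its
derivative `⟨ψ, w⟩` vanishes; the final projection fixes `w`. -/
lemma hasStrictDirDeriv_affineOp (ψ : Sphere n μ) (w : horiz μ ψ.1) :
    HasStrictDirDeriv (affineOp μ ψ) ψ.1 w.1 w := by
  let L : SmoothFun n M ℂ →L[ℝ] SmoothFun n M (ℂ × ℂ) :=
    pairL.comp ((ContinuousLinearMap.id ℝ _).prod (constL.comp (l2L μ ψ.1)))
  have hL : ∀ χ x, L χ x = (χ x, l2 μ ψ.1 χ) := fun χ x => pairL_apply _ _ _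
  have hmem : L ψ.1 ∈ valuesIn n M {a : ℂ × ℂ | a.2 ≠ 0} := fun x => by
    rw [hL, ψ.l2_self]
    exact one_ne_zero
  have h := (hasStrictDirDeriv_compOp isOpen_snd_ne_zero (contDiffOn_div (K := ℂ)) hmem
    (L w.1)).comp (ContinuousLinearMap.hasStrictDirDeriv L ψ.1 w.1) L.continuous.continuousAt
  have e : compOp (totalDeriv fun p : ℂ × ℂ => p.1 / p.2) (pairL (L ψ.1, L w.1)) = w.1 := by
    ext x
    rw [compOp_apply (isOpen_snd_ne_zero.prod isOpen_univ)
      (contDiffOn_totalDeriv isOpen_snd_ne_zero contDiffOn_div) (pairL_mem_valuesIn hmem _),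
      pairL_apply, hL, hL, ψ.l2_self, show l2 μ ψ.1 w.1 = 0 from w.2, totalDeriv_div]
  rw [e] at h
  have hc : ContinuousAt (divOp (l2L μ ψ.1)) ψ.1 :=
    (strictCkOn_divOp (l2L μ ψ.1) 0).continuousOn.continuousAt
      ((isOpen_ne_zero (l2L μ ψ.1)).mem_nhds (by
        change l2 μ ψ.1 ψ.1 ≠ 0
        rw [ψ.l2_self]; exact one_ne_zero))
  have h' := (ContinuousLinearMap.hasStrictDirDeriv (horizProj μ ψ) (divOp (l2L μ ψ.1) ψ.1)
    w.1).comp (f := divOp (l2L μ ψ.1)) h hc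
  rw [horizProj_coe] at h'
  exact h'

/-- The Madelung transform in charts, expressed through a representative of the phase. -/
lemma madelung_in_charts (ρ₀ : Dens n μ) (φ : Sphere n μ)
    (a : meanZero n μ × (SmoothFun n M ℝ ⧸ constants n M)) (θ : SmoothFun n M ℝ)
    (hθ : a.2 = Submodule.Quotient.mk θ) (h : ∀ x, 0 < (ρ₀.1 + a.1.1) x)
    (hl : l2 μ φ.1 (polarOp (ρ₀.1 + a.1.1, θ)) ≠ 0) :
    (projChart μ φ).chart (madelung μ ((cotChart μ ρ₀).chart.symm a)) =
      affineOp μ φ (polarOp (ρ₀.1 + a.1.1, θ)) := by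
  obtain ⟨ρ, hρ, e⟩ := cotChart_symm μ ρ₀ a h
  rw [e, hθ, madelung_mk]
  have h1 : (madelungSphere μ ρ θ).1 = polarOp (ρ₀.1 + a.1.1, θ) := by
    rw [← hρ]; exact madelungFun_eq_polarOp μ ρ θ
  rw [← h1] at hl ⊢
  exact affineCoord_eq μ φ (madelungSphere μ ρ θ) hl

/-- The strict chain rule is applied to functions, with the phase `θ` fixed by the representative
`ψ`. Only afterwards is the result read in charts, along a single line. -/
lemma hasDirDeriv_madelung (p : CotDens n μ) (ψ : Sphere n μ) (θ : SmoothFun n M ℝ)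
    (hp : p.2 = Submodule.Quotient.mk θ) (hψ : madelungFun μ p.1 θ = ψ.1) (ρ₀ : Dens n μ)
    (v : cotTangent μ p) (w : horiz μ ψ.1) (hw : w.1 = waveDeriv μ p ψ.1 v.1) :
    HasDirDeriv (fun a => (projChart μ ψ).chart (madelung μ ((cotChart μ ρ₀).chart.symm a)))
      ((cotChart μ ρ₀).chart p) (cotTangent.coord μ v) w := by
  have hpol : polarOp (p.1.1, θ) = ψ.1 := by rw [← madelungFun_eq_polarOp, hψ]
  have hs : IsOpen {q : SmoothFun n M ℝ × SmoothFun n M ℝ | ∀ x, 0 < q.1 x} := isOpen_pos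
  have hcont := (strictCkOn_polarOp (n := n) (M := M) 0).continuousOn
  have h1 := hasStrictDirDeriv_polarOp μ p θ v.1
  rw [hψ, ← hw] at h1
  have h2 : HasStrictDirDeriv (affineOp μ ψ) (polarOp (p.1.1, θ)) w.1 w := by
    rw [hpol]
    exact hasStrictDirDeriv_affineOp μ ψ w
  have h3 := (h2.comp h1 (hcont.continuousAt (hs.mem_nhds p.1.2.1))).hasDirDeriv
  have hopen : IsOpen ({q : SmoothFun n M ℝ × SmoothFun n M ℝ | ∀ x, 0 < q.1 x} ∩
      polarOp ⁻¹' {χ | l2 μ ψ.1 χ ≠ 0}) :=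
    hcont.isOpen_inter_preimage hs (isOpen_ne_zero (l2L μ ψ.1))
  have hmem : (p.1.1, θ) ∈ {q : SmoothFun n M ℝ × SmoothFun n M ℝ | ∀ x, 0 < q.1 x} ∩
      polarOp ⁻¹' {χ | l2 μ ψ.1 χ ≠ 0} := by
    refine ⟨p.1.2.1, ?_⟩
    change l2 μ ψ.1 (polarOp (p.1.1, θ)) ≠ 0
    rw [hpol, ψ.l2_self]
    exact one_ne_zero
  let a₀ : meanZero n μ × (SmoothFun n M ℝ ⧸ constants n M) := (cotChart μ ρ₀).chart p
  let c : meanZero n μ × (SmoothFun n M ℝ ⧸ constants n M) := cotTangent.coord μ v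
  let f : meanZero n μ × (SmoothFun n M ℝ ⧸ constants n M) → horiz μ ψ.1 :=
    fun a => (projChart μ ψ).chart (madelung μ ((cotChart μ ρ₀).chart.symm a))
  have hchart : ∀ t : ℝ, (p.1.1, θ) + t • v.1 ∈
      {q : SmoothFun n M ℝ × SmoothFun n M ℝ | ∀ x, 0 < q.1 x} ∩
        polarOp ⁻¹' {χ | l2 μ ψ.1 χ ≠ 0} →
      f (a₀ + t • c) = affineOp μ ψ (polarOp ((p.1.1, θ) + t • v.1)) := by
    intro t ht
    have e : ρ₀.1 + (a₀ + t • c).1.1 = p.1.1 + t • v.1.1 := by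
      change ρ₀.1 + ((p.1.1 - ρ₀.1) + t • v.1.1) = _
      abel
    have e' : ((p.1.1, θ) + t • v.1 : SmoothFun n M ℝ × SmoothFun n M ℝ) =
        (p.1.1 + t • v.1.1, θ + t • v.1.2) := rfl
    have e'' : (a₀ + t • c).2 = Submodule.Quotient.mk (θ + t • v.1.2) := by
      rw [Submodule.Quotient.mk_add, ← hp, Submodule.Quotient.mk_smul]
      rfl
    rw [e', ← e] at ht ⊢
    exact madelung_in_charts μ ρ₀ ψ _ _ e'' ht.1 ht.2
  have hzero : f a₀ = affineOp μ ψ (polarOp (p.1.1, θ)) := by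
    simpa using hchart 0 (by rwa [zero_smul, add_zero])
  -- For small `t` the density stays positive and the overlap with `ψ` nonzero, so the chart formula
  -- is valid on the difference quotients.
  have hev : ∀ᶠ t : ℝ in 𝓝[≠] 0, (p.1.1, θ) + t • v.1 ∈
      {q : SmoothFun n M ℝ × SmoothFun n M ℝ | ∀ x, 0 < q.1 x} ∩
        polarOp ⁻¹' {χ | l2 μ ψ.1 χ ≠ 0} := by
    have hc : Continuous fun t : ℝ =>
        ((p.1.1, θ) + t • v.1 : SmoothFun n M ℝ × SmoothFun n M ℝ) := by fun_prop
    have := hc.tendsto 0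
    rw [zero_smul, add_zero] at this
    exact (this.mono_left nhdsWithin_le_nhds).eventually (hopen.mem_nhds hmem)
  have hfin : HasDirDeriv f a₀ c w := by
    refine Tendsto.congr' ?_ h3
    filter_upwards [hev] with t ht
    rw [hchart t ht, hzero]
    rfl
  exact hfin

end Differential

end MadelungKahler
end

open MadelungKahler in
theorem theorem2 {n : ℕ} {M : Type*} [TopologicalSpace M]
    [ChartedSpace (EuclideanSpace ℝ (Fin n)) M] [IsManifold (𝓡 n) ∞ M] [T2Space M]
    [CompactSpace M] [ConnectedSpace M] [MeasurableSpace M] [BorelSpace M]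
    (μ : Measure M) [IsFiniteMeasure μ] (hμ : IsSmoothVolume n μ) :
    -- `Φ` is a diffeomorphism onto an open subset of projective space
    (IsOpen (range (madelung (n := n) μ)) ∧ Function.Injective (madelung (n := n) μ) ∧
      MapSmoothOn (cotAtlas n μ) (projAtlas n μ) (madelung μ) univ ∧
      ∃ Ψ : ProjWave n μ → CotDens n μ, Function.LeftInverse Ψ (madelung μ) ∧
        MapSmoothOn (projAtlas n μ) (cotAtlas n μ) Ψ (range (madelung μ))) ∧
    -- its image consists of nowhere vanishing wave functions, and of all of them
    -- if `M` is simply connected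
    (range (madelung (n := n) μ) ⊆ nonvanishing n μ ∧
      (SimplyConnectedSpace M → range (madelung (n := n) μ) = nonvanishing n μ)) ∧
    -- the almost Hermitian structure of the cotangent bundle
    (∀ (p : CotDens n μ) (v w : cotTangent μ p),
      cotJ μ (cotJ μ v) = -v ∧ (v ≠ 0 → 0 < sasakiFisherRao μ v v) ∧
      sasakiFisherRao μ (cotJ μ v) w = 1 / 4 * canonicalForm μ v w) ∧
    -- at each point the differential of `Φ` preserves metric, symplectic form and complex structure
    ∀ (p : CotDens n μ) (ψ : Sphere n μ), madelung μ p = ProjWave.mk μ ψ →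
      ∃ D : cotTangent μ p ≃ₗ[ℝ] horiz μ ψ.1,
        (∀ (ρ₀ : Dens n μ) (v : cotTangent μ p),
          HasDirDeriv
            (fun a => (projChart μ ψ).chart (madelung μ ((cotChart μ ρ₀).chart.symm a)))
            ((cotChart μ ρ₀).chart p) (cotTangent.coord μ v) (D v)) ∧
        ∀ v w : cotTangent μ p,
          fubiniStudy μ ψ.1 (D v).1 (D w).1 = sasakiFisherRao μ v w ∧
          4 * projForm μ ψ.1 (D v).1 (D w).1 = canonicalForm μ v w ∧
          (D (cotJ μ v)).1 = cmul Complex.I (D v).1 := by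
  have := hμ.isOpenPosMeasure
  -- `Function.invFun` needs a junk value off the image; the constant density exists because `μ` is
  -- positive on open sets.
  have hne : Nonempty (CotDens n μ) := nonempty_cotDens μ
  refine ⟨⟨isOpen_range_madelung μ, madelung_injective μ,
    ⟨(continuous_madelung μ).continuousOn, ?_⟩, Function.invFun (madelung μ),
    Function.leftInverse_invFun (madelung_injective μ), continuousOn_invFun_madelung μ, ?_⟩,
    ⟨range_madelung_subset μ, fun _ => range_madelung_eq μ⟩,
    fun p v w => ⟨cotJ_cotJ μ v, sasakiFisherRao_pos μ v, sasakiFisherRao_cotJ μ v w⟩,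
    fun p ψ h => ?_⟩
  · rintro _ ⟨ρ₀, rfl⟩ _ ⟨φ, rfl⟩
    exact madelung_smooth_in_charts μ ρ₀ φ
  · rintro _ ⟨φ, rfl⟩ _ ⟨ρ₀, rfl⟩
    exact invFun_madelung_smooth_in_charts μ ρ₀ φ
  -- The phase is adjusted so that its transform is the given `ψ` itself and not merely a multiple
  -- of it, since the horizontal space depends on the representative.
  · obtain ⟨θ, hp, hψ⟩ := exists_phase μ p ψ h
    have hn : ∀ x, ‖ψ.1 x‖ ^ 2 = p.1.1 x := fun x => by rw [← hψ, normSq_madelungFun]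
    obtain ⟨D, hD⟩ := exists_waveDeriv_equiv μ p ψ hn
    refine ⟨D, fun ρ₀ v => hasDirDeriv_madelung μ p ψ θ hp hψ ρ₀ v (D v) (hD v),
      fun v w => ⟨?_, ?_, ?_⟩⟩
    · rw [fubiniStudy, hD, hD, hermitianFubiniStudy_waveDeriv μ ψ hn,
        l2_waveDeriv_waveDeriv_re μ hn]
    · rw [projForm, hD, hD, hermitianFubiniStudy_waveDeriv μ ψ hn,
        l2_waveDeriv_waveDeriv_im μ hn]
    · rw [hD, hD, waveDeriv_cotJ]
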